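/- Let $X$ be a (real or complex) Banach space and let $A : X \to X$ be a bounded linear operator of positive type, i.e. there is $\kappa_* > 0$ such that for every $\alpha > 0$ the operator $A + \alpha I$ is one-to-one and onto with $\|(A+\alpha I)^{-1}\| \le \kappa_*/\alpha$. Assume that $A$ is one-to-one and that $A^{-1}$ (defined on the range of $A$) is unbounded. Fractional powers of $A$ are defined by $A^0 = I$, by $A^p u = \frac{\sin \pi p}{\pi}\int_0^\infty s^{p-1}(A+sI)^{-1}Au\,ds$ for $0<p<1$, and by $A^p = A^{p-\lfloor p\rfloor}A^{\lfloor p\rfloor}$ for general $p \ge 0$. The logarithm of $A$ is $(\log A)u = \lim_{p\downarrow 0}\frac1p(A^pu-u)$, with domain $\mathcal D(\log A)$ consisting of all $u \in X$ for which this limit exists; $\mathcal D((\log A)^\nu)$ denotes the domain of its $\nu$-th power. Let $R_\alpha : X \to X$ $(\alpha>0)$ be bounded linear operators, let $S_\alpha = I - R_\alpha A$, and let $0 < p_0 \le \infty$ be such that, with finite constants $c_*$ and $e_q$, $$\|R_\alpha\| \le \frac{c_*}{\alpha}, \qquad R_\alpha A = A R_\alpha \qquad (\alpha > 0), \qquad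 \|S_\alpha A^q\| \le e_q \alpha^q \quad (\alpha>0,\ 0 \le q \le p_0,\ q < \infty),$$ where $q \mapsto e_q$ is bounded on bounded intervals. Fix a real number $p$ with $0 \le p < p_0$, an integer $\nu \ge 1$, a real number $\lambda > \log\|A\|$, and constants $c > 0$ and $0 < \delta_0 < 1$. Consider the a priori parameter choice $$\alpha_\delta = c\,\delta^{\frac1{p+1}}\Bigl(\log\tfrac1\delta\Bigr)^{\frac{\nu}{p+1}}, \qquad 0 < \delta \le \delta_0 .$$ Then there is a finite constant $C > 0$ such that the following holds. Whenever $\bar u, u^\dagger, f^\dagger \in X$ satisfy $Au^\dagger = f^\dagger$ and the mixed smoothness condition $$\bar u - u^\dagger = A^p v \quad \text{for some } v \in \mathcal D((\log A)^\nu),$$ with source element $w = (\lambda I - \log A)^\nu v$, and whenever $0<\delta\le\delta_0$ and $f^\delta \in X$ with $\|f^\dagger - f^\delta\| \le \delta$, the regularizing element $u_{\alpha}^\delta = \bar u - R_{\alpha}(A\bar u - f^\delta)$ with $\alpha = \alpha_\delta$ satisfies $$\|u_{\alpha_\delta}^\delta - u^\dagger\| \le C \max\{\|w\|,1\}\, \delta^{\frac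 p{p+1}}\Bigl(\log\tfrac1\delta\Bigr)^{-\frac\nu{p+1}} .$$ In particular, $C$ is independent of $\delta$ and $w$. -/

import Mathlib

open Filter Topology MeasureTheory Set
open scoped ENNReal

noncomputable section

namespace LogSource

section Defs

variable {𝕜 X : Type*} [RCLike 𝕜] [NormedAddCommGroup X] [NormedSpace 𝕜 X]
  [NormedSpace ℝ X] [IsScalarTower ℝ 𝕜 X]

/-- The inverse `(A + sI)⁻¹` as a bounded operator (it is `0` by convention when `A + sI` is not
boundedly invertible, which never happens for `s > 0` and `A` of positive type). -/
def resolventAt (A : X →L[𝕜] X) (s : ℝ) : X →L[𝕜] X :=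
  Ring.inverse (A + s • (1 : X →L[𝕜] X))

/-- `A` is of positive type: for all `α > 0` the operator `A + αI` is one-to-one and onto and
`‖(A + αI)⁻¹‖ ≤ κ / α`, for some finite constant `κ > 0`. -/
def IsPositiveType (A : X →L[𝕜] X) : Prop :=
  ∃ κ : ℝ, 0 < κ ∧ ∀ α : ℝ, 0 < α →
    Function.Bijective (A + α • (1 : X →L[𝕜] X)) ∧ ‖resolventAt A α‖ ≤ κ / α

/-- The Balakrishnan integral
`(sin πp / π) ∫₀^∞ s^(p-1) (A + sI)⁻¹ A ds`, which defines `A^p` for `0 < p < 1`. The integral is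
taken in the space of bounded operators; `balakrishnan_apply` shows that, for `A` of
positive type, it is given pointwise by the corresponding `X`-valued Bochner integral. -/
def balakrishnan (A : X →L[𝕜] X) (p : ℝ) : X →L[𝕜] X :=
  (Real.sin (Real.pi * p) / Real.pi) •
    ∫ s in Ioi (0 : ℝ), s ^ (p - 1) • (resolventAt A s * A)

/-- The fractional power `A^p`, `p ≥ 0`: `A^p = A^(p - ⌊p⌋) A^⌊p⌋` with `A^0 = I`, where powers with
exponent in `(0,1)` are given by the Balakrishnan integral. -/
def fracPow (A : X →L[𝕜] X) (p : ℝ) : X →L[𝕜] X :=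
  (if Int.fract p = 0 then 1 else balakrishnan A (Int.fract p)) * A ^ ⌊p⌋₊

/-- The domain of `log A`, the infinitesimal generator of the family `(A^p)_{p ≥ 0}`: all `u` for
which `lim_{p ↓ 0} (A^p u - u) / p` exists. -/
def logDomain (A : X →L[𝕜] X) : Set X :=
  {u | ∃ y : X, Tendsto (fun p : ℝ => p⁻¹ • (fracPow A p u - u)) (𝓝[>] 0) (𝓝 y)}

/-- `(log A) u = lim_{p ↓ 0} (A^p u - u) / p`; meaningful for `u ∈ logDomain A`. -/
def logOp (A : X →L[𝕜] X) (u : X) : X :=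
  limUnder (𝓝[>] (0 : ℝ)) (fun p : ℝ => p⁻¹ • (fracPow A p u - u))

/-- The domain of the power `(log A)^ν`. -/
def logPowDomain (A : X →L[𝕜] X) : ℕ → Set X
  | 0 => univ
  | n + 1 => {v | v ∈ logDomain A ∧ logOp A v ∈ logPowDomain A n}

/-- The source element `(μI - log A)^ν v`; meaningful for `v ∈ logPowDomain A ν`, in which case all
the intermediate iterates lie in `logDomain A`. -/
def sourceElement (A : X →L[𝕜] X) (μ : ℝ) (ν : ℕ) (v : X) : X :=
  (fun x => μ • x - logOp A x)^[ν] v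

/-- The companion operators `S_α = I - R_α A`. -/
def companion (A : X →L[𝕜] X) (R : ℝ → X →L[𝕜] X) (α : ℝ) : X →L[𝕜] X :=
  1 - R α * A

/-- A family `R_α`, `α > 0`, of bounded regularization operators for `A`, with saturation
`p₀ ∈ [0, ∞]`. For `p₀ = ∞` the decay condition is required for all finite `p ≥ 0`. -/
structure IsRegularization (A : X →L[𝕜] X) (R : ℝ → X →L[𝕜] X) (p₀ : ℝ≥0∞) : Prop where
  growth : ∃ c : ℝ, ∀ α : ℝ, 0 < α → ‖R α‖ ≤ c / α
  decay : ∃ e : ℝ → ℝ,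
    (∀ M : ℝ, ∃ B : ℝ, ∀ p : ℝ, 0 ≤ p → p ≤ M → ENNReal.ofReal p ≤ p₀ → e p ≤ B) ∧
    ∀ p : ℝ, 0 ≤ p → ENNReal.ofReal p ≤ p₀ → ∀ α : ℝ, 0 < α →
      ‖companion A R α * fracPow A p‖ ≤ e p * α ^ p
  commute : ∀ α : ℝ, 0 < α → R α * A = A * R α

/-- The regularizing element `u_α^δ = ū - R_α (A ū - f^δ)`. -/
def regElement (A : X →L[𝕜] X) (R : ℝ → X →L[𝕜] X) (ubar fδ : X) (α : ℝ) : X :=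
  ubar - R α (A ubar - fδ)

/-- The a priori parameter choice `α_δ = c δ^(1/(p+1)) (log (1/δ))^(ν/(p+1))`. -/
def aprioriParam (c p : ℝ) (ν : ℕ) (δ : ℝ) : ℝ :=
  c * δ ^ (1 / (p + 1)) * Real.log (1 / δ) ^ ((ν : ℝ) / (p + 1))

theorem IsPositiveType.isUnit [CompleteSpace X] {A : X →L[𝕜] X} (hA : IsPositiveType A) {s : ℝ}
    (hs : 0 < s) : IsUnit (A + s • (1 : X →L[𝕜] X)) := by
  obtain ⟨κ, -, h⟩ := hA
  exact ContinuousLinearMap.isUnit_iff_bijective.2 (h s hs).1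

theorem IsPositiveType.integrableOn [CompleteSpace X] {A : X →L[𝕜] X} (hA : IsPositiveType A)
    {p : ℝ} (hp : 0 < p) (hp1 : p < 1) :
    IntegrableOn (fun s : ℝ => s ^ (p - 1) • (resolventAt A s * A)) (Ioi 0) := by
  have hcont : ContinuousOn (fun s : ℝ => s ^ (p - 1) • (resolventAt A s * A)) (Ioi 0) := by
    intro s hs
    have hs' : (0 : ℝ) < s := hs
    obtain ⟨u, hu⟩ := hA.isUnit hs'
    have h1 : ContinuousAt (fun s : ℝ => resolventAt A s) s := by
      have h2 : ContinuousAt (fun s : ℝ => A + s • (1 : X →L[𝕜] X)) s := by fun_prop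
      have h3 := NormedRing.inverse_continuousAt u
      rw [hu] at h3
      exact ContinuousAt.comp (f := fun s : ℝ => A + s • (1 : X →L[𝕜] X)) h3 h2
    have h4 : ContinuousAt (fun s : ℝ => s ^ (p - 1)) s :=
      Real.continuousAt_rpow_const _ _ (Or.inl hs'.ne')
    exact (h4.smul (h1.mul continuousAt_const)).continuousWithinAt
  obtain ⟨κ, hκ, h⟩ := id hA
  have hmeas := fun t (ht : t ⊆ Ioi (0 : ℝ)) (hm : MeasurableSet t) =>
    (hcont.mono ht).aestronglyMeasurable (μ := volume) hm
  rw [← Ioc_union_Ioi_eq_Ioi (zero_le_one' ℝ)]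
  refine IntegrableOn.union ?_ ?_
  · have hg : IntegrableOn (fun s : ℝ => (1 + κ) * s ^ (p - 1)) (Ioc 0 1) := by
      refine Integrable.const_mul ?_ _
      exact (intervalIntegrable_iff_integrableOn_Ioc_of_le zero_le_one).1
        (intervalIntegral.intervalIntegrable_rpow' (by linarith))
    refine Integrable.mono' hg (hmeas _ (fun x hx => hx.1) measurableSet_Ioc) ?_
    filter_upwards [ae_restrict_mem measurableSet_Ioc] with s hs
    have h1 : resolventAt A s * A = 1 - s • resolventAt A s := by
      have := Ring.inverse_mul_cancel _ (hA.isUnit hs.1)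
      rw [mul_add] at this
      rw [eq_sub_iff_add_eq, ← this]
      simp [resolventAt]
    have hone : ‖(1 : X →L[𝕜] X)‖ ≤ 1 := ContinuousLinearMap.norm_id_le
    have h2 : ‖resolventAt A s * A‖ ≤ 1 + κ := by
      rw [h1]
      refine (norm_sub_le _ _).trans (add_le_add hone ?_)
      rw [norm_smul, Real.norm_of_nonneg hs.1.le]
      have := mul_le_mul_of_nonneg_left (h s hs.1).2 hs.1.le
      rwa [mul_div_cancel₀ _ hs.1.ne'] at this
    rw [norm_smul, Real.norm_of_nonneg (Real.rpow_nonneg hs.1.le _), mul_comm]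
    exact mul_le_mul_of_nonneg_right h2 (Real.rpow_nonneg hs.1.le _)
  · have hg : IntegrableOn (fun s : ℝ => (κ * ‖A‖) * s ^ (p - 2)) (Ioi 1) :=
      Integrable.const_mul (integrableOn_Ioi_rpow_of_lt (by linarith) one_pos) _
    refine Integrable.mono' hg (hmeas _ (fun x (hx : 1 < x) => mem_Ioi.2 (zero_lt_one.trans hx)) measurableSet_Ioi) ?_
    filter_upwards [ae_restrict_mem measurableSet_Ioi] with s hs
    have hs' : (0 : ℝ) < s := zero_lt_one.trans hs
    rw [norm_smul, Real.norm_of_nonneg (Real.rpow_nonneg hs'.le _)]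
    have h2 : ‖resolventAt A s * A‖ ≤ κ / s * ‖A‖ :=
      (norm_mul_le _ _).trans (mul_le_mul_of_nonneg_right (h s hs').2 (norm_nonneg _))
    refine (mul_le_mul_of_nonneg_left h2 (Real.rpow_nonneg hs'.le _)).trans_eq ?_
    rw [show p - 2 = (p - 1) - 1 by ring, Real.rpow_sub_one hs'.ne' (p - 1)]
    ring

/-- The Balakrishnan integral, pointwise. -/
theorem balakrishnan_apply [CompleteSpace X] {A : X →L[𝕜] X} (hA : IsPositiveType A) {p : ℝ}
    (hp : 0 < p) (hp1 : p < 1) (u : X) :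
    balakrishnan A p u = (Real.sin (Real.pi * p) / Real.pi) •
      ∫ s in Ioi (0 : ℝ), s ^ (p - 1) • (resolventAt A s (A u)) := by
  simp only [balakrishnan, _root_.smul_apply]
  rw [ContinuousLinearMap.integral_apply (hA.integrableOn hp hp1)]
  rfl

end Defs

end LogSource

end

/-!
The error splits as `u_α^δ - u† = S_α A^p v - R_α (f† - f^δ)`. The second term is at most
`c_* δ / α`, so everything rests on the estimate
`‖S_α A^p v‖ ≤ C α^p (log (1/α))^(-ν) ‖(μI - log A)^ν v‖` for small `α`
(`IsPositiveType.exists_norm_companion_le`); inserting `α_δ` and using that `log (1/α_δ)` is of the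
order of `log (1/δ)` then gives the rate for both terms.

To prove the estimate, write `α^t = e^(-Lt)` with `L = log (1/α)`. The decay condition says that
`B = S_α A^p` satisfies `‖B A^t‖ ≤ E α^p e^(-Lt)` on a short interval `[0, T]`. The function
`t ↦ e^(-μt) B A^t x` has right derivative `-e^(-μt) B A^t (μI - log A) x`, and integrating the
exponential bound once gains one factor `1/L`, at the price of a remainder `e^(-LT)`, which is
smaller than any power of `1/L`. Induction on `ν` gives
`IsPositiveType.exists_norm_le_of_exp_decay`. The remainder involves `‖v‖`, which is controlled by
the source element since `μI - log A` is bounded below: compare `e^(-μt) A^t x` at `t = 0` and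
`t = 1` and use `e^(-μ) ‖A‖ < 1`. Only a mean value inequality for right derivatives is used, and
neither the resolvent of `log A` nor integrals over an infinite time interval occur.

What has to be known about the fractional powers is that they are bounded on `[0, 1]`, that
`A^q → A` as `q ↑ 1`, and that `A^a A^b = A^(a+b)` for `a + b < 1`. For the last point, the
substitution `t = rs` in the double integral for `A^a A^b` and the resolvent identity show that
the product is a multiple of `A^(a+b)`, with a factor that is the same for all operators
(`IsResolventFamily.integral_mul_integral_eq_smul`). The scalar `1` in place of `A`, for which
`∫₀^∞ s^(a-1) / (1 + s) ds = π / sin πa` by Euler's reflection formula, identifies this factor.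
-/

namespace LogSource

/-! ### The integral `∫₀^∞ s^(a-1) / (1 + s) ds` -/

/-- Euler's Beta integral `B(a, 1 - a)` over the unit interval. -/
theorem setIntegral_Ioo_rpow_mul_one_sub_rpow {a : ℝ} (ha : 0 < a) (ha1 : a < 1) :
    ∫ x in Ioo (0 : ℝ) 1, x ^ (a - 1) * (1 - x) ^ (-a) = Real.pi / Real.sin (Real.pi * a) := by
  have h1 : Complex.betaIntegral (a : ℂ) ((1 - a : ℝ) : ℂ)
      = ((∫ x in Ioo (0 : ℝ) 1, x ^ (a - 1) * (1 - x) ^ (-a) : ℝ) : ℂ) := by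
    rw [Complex.betaIntegral, intervalIntegral.integral_of_le zero_le_one,
      integral_Ioc_eq_integral_Ioo, ← integral_complex_ofReal]
    refine setIntegral_congr_fun measurableSet_Ioo fun x hx => ?_
    have h0 : (0 : ℝ) ≤ x := hx.1.le
    have h0' : (0 : ℝ) ≤ 1 - x := by linarith [hx.2]
    simp only [Complex.ofReal_mul, Complex.ofReal_cpow h0, Complex.ofReal_cpow h0']
    push_cast
    congr 2
    ring
  rw [Complex.betaIntegral_eq_Gamma_mul_div _ _ (by simpa using ha) (by simpa using ha1)] at h1
  have h2 : (a : ℂ) + ((1 - a : ℝ) : ℂ) = 1 := by push_cast; ring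
  rw [h2, Complex.Gamma_one, div_one, Complex.Gamma_ofReal, Complex.Gamma_ofReal,
    ← Complex.ofReal_mul, Real.Gamma_mul_Gamma_one_sub] at h1
  exact_mod_cast h1.symm

theorem integral_rpow_div_one_add {a : ℝ} (ha : 0 < a) (ha1 : a < 1) :
    ∫ s in Ioi (0 : ℝ), s ^ (a - 1) * (1 + s)⁻¹ = Real.pi / Real.sin (Real.pi * a) := by
  rw [← setIntegral_Ioo_rpow_mul_one_sub_rpow ha ha1]
  have himg : (fun x : ℝ => x / (1 - x)) '' Ioo 0 1 = Ioi 0 := by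
    ext y
    constructor
    · rintro ⟨x, hx, rfl⟩
      exact div_pos hx.1 (by linarith [hx.2])
    · intro hy
      have hy' : (0 : ℝ) < y := hy
      refine ⟨y / (1 + y), ⟨by positivity, by rw [div_lt_one (by linarith)]; linarith⟩, ?_⟩
      have : (1 + y) ≠ 0 := by positivity
      field_simp
      ring
  have hinj : InjOn (fun x : ℝ => x / (1 - x)) (Ioo 0 1) := by
    intro x hx y hy hxy
    have h1 : (1 - x) ≠ 0 := by linarith [hx.2]
    have h2 : (1 - y) ≠ 0 := by linarith [hy.2]
    simp only at hxy
    rw [div_eq_div_iff h1 h2] at hxy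
    linarith
  have hder : ∀ x ∈ Ioo (0 : ℝ) 1,
      HasDerivWithinAt (fun x : ℝ => x / (1 - x)) (((1 - x) ^ 2)⁻¹) (Ioo 0 1) x := by
    intro x hx
    have h1 : (1 - x) ≠ 0 := by linarith [hx.2]
    have := ((hasDerivAt_id x).div ((hasDerivAt_id x).const_sub 1) h1).hasDerivWithinAt
      (s := Ioo 0 1)
    convert! this using 1
    simp only [id]
    field_simp
    ring
  rw [← himg, integral_image_eq_integral_abs_deriv_smul measurableSet_Ioo hder hinj]
  refine setIntegral_congr_fun measurableSet_Ioo fun x hx => ?_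
  have h0 : (0 : ℝ) < x := hx.1
  have h1 : (0 : ℝ) < 1 - x := by linarith [hx.2]
  simp only [smul_eq_mul]
  rw [abs_of_pos (by positivity), Real.div_rpow h0.le h1.le,
    show (1 - x) ^ (-a) = ((1 - x) ^ (a - 1))⁻¹ * (1 - x)⁻¹ by
      rw [← Real.rpow_neg h1.le, ← Real.rpow_neg_one, ← Real.rpow_add h1]; congr 1; ring]
  have h2 : 1 + x / (1 - x) = (1 - x)⁻¹ := by field_simp; ring
  have h3 : (1 - x) ^ (a - 1) ≠ 0 := (Real.rpow_pos_of_pos h1 _).ne'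
  rw [h2]
  field_simp

/-! ### Products of Balakrishnan-type integrals -/

theorem integrableOn_rpow_div_one_add {a : ℝ} (ha : 0 < a) (ha1 : a < 1) :
    IntegrableOn (fun s : ℝ => s ^ (a - 1) * (1 + s)⁻¹) (Ioi 0) := by
  by_contra h
  have h1 := integral_rpow_div_one_add ha ha1
  rw [integral_undef h] at h1
  have h2 : 0 < Real.sin (Real.pi * a) :=
    Real.sin_pos_of_pos_of_lt_pi (by positivity) (by nlinarith [Real.pi_pos])
  have := div_pos Real.pi_pos h2
  linarith

section Banach

variable {𝔸 : Type*} [NormedRing 𝔸] [NormedSpace ℝ 𝔸]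

/-- The algebraic and metric properties of the family `s ↦ A (A + sI)⁻¹`, `s > 0`, for an operator
`A` of positive type, on which the calculus of the Balakrishnan integrals rests. -/
structure IsResolventFamily (G : ℝ → 𝔸) (K : ℝ) : Prop where
  continuousOn : ContinuousOn G (Ioi 0)
  norm_le : ∀ s, 0 < s → ‖G s‖ ≤ K * (1 + s)⁻¹
  mul : ∀ s t, 0 < s → 0 < t → (t - s) • (G s * G t) = t • G t - s • G s

theorem IsResolventFamily.integrableOn {G : ℝ → 𝔸} {K : ℝ} (hG : IsResolventFamily G K)
    {a : ℝ} (ha : 0 < a) (ha1 : a < 1) :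
    IntegrableOn (fun s : ℝ => s ^ (a - 1) • G s) (Ioi 0) := by
  have hm : AEStronglyMeasurable (fun s : ℝ => s ^ (a - 1) • G s) (volume.restrict (Ioi 0)) := by
    refine ContinuousOn.aestronglyMeasurable ?_ measurableSet_Ioi
    exact ContinuousOn.smul (fun s hs => (Real.continuousAt_rpow_const _ _
      (Or.inl (ne_of_gt hs))).continuousWithinAt) hG.continuousOn
  refine Integrable.mono' ((integrableOn_rpow_div_one_add ha ha1).const_mul K) hm ?_
  filter_upwards [ae_restrict_mem measurableSet_Ioi] with s hs
  have hs' : (0 : ℝ) < s := hs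
  rw [norm_smul, Real.norm_of_nonneg (Real.rpow_nonneg hs'.le _)]
  calc _ ≤ s ^ (a - 1) * (K * (1 + s)⁻¹) :=
        mul_le_mul_of_nonneg_left (hG.norm_le s hs') (Real.rpow_nonneg hs'.le _)
    _ = _ := by ring

theorem isResolventFamily_inv_one_add : IsResolventFamily (fun s : ℝ => (1 + s)⁻¹) 1 where
  continuousOn := by
    refine ContinuousOn.inv₀ (by fun_prop) fun s hs => ?_
    have : (0 : ℝ) < s := hs
    positivity
  norm_le s hs := by rw [Real.norm_of_nonneg (by positivity), one_mul]
  mul s t hs ht := by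
    simp only [smul_eq_mul]
    field_simp
    ring

/-- Scaling: `∫₀^∞ s^(a-1) G(rs) ds = r^(-a) ∫₀^∞ s^(a-1) G(s) ds`. -/
theorem integral_rpow_smul_comp_mul (G : ℝ → 𝔸) (a : ℝ) {r : ℝ} (hr : 0 < r) :
    ∫ s in Ioi (0 : ℝ), s ^ (a - 1) • G (r * s)
      = r ^ (-a) • ∫ s in Ioi (0 : ℝ), s ^ (a - 1) • G s := by
  have h := integral_comp_mul_left_Ioi (fun s : ℝ => s ^ (a - 1) • G s) 0 hr
  rw [mul_zero] at h
  have h2 : ∫ s in Ioi (0 : ℝ), (r * s) ^ (a - 1) • G (r * s)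
      = r ^ (a - 1) • ∫ s in Ioi (0 : ℝ), s ^ (a - 1) • G (r * s) := by
    rw [← integral_smul]
    refine setIntegral_congr_fun measurableSet_Ioi fun s hs => ?_
    rw [Real.mul_rpow hr.le (le_of_lt hs), mul_smul]
  rw [h2] at h
  have h3 : r ^ (a - 1) ≠ 0 := (Real.rpow_pos_of_pos hr _).ne'
  rw [← inv_smul_smul₀ h3 (∫ s in Ioi (0 : ℝ), s ^ (a - 1) • G (r * s)), h, smul_smul]
  congr 1
  rw [Real.rpow_neg hr.le, Real.rpow_sub_one hr.ne']
  have := (Real.rpow_pos_of_pos hr a).ne'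
  field_simp

/-- Absolute convergence of the double integral that represents the product of two Balakrishnan-type
integrals, after the substitution `t = r s` in the inner one. -/
theorem IsResolventFamily.integrable_prod {G : ℝ → 𝔸} {K : ℝ} (hG : IsResolventFamily G K)
    {a b : ℝ} (ha : 0 < a) (ha1 : a < 1) (hb : 0 < b) (hb1 : b < 1) :
    Integrable (Function.uncurry fun s r : ℝ =>
        (s ^ (a + b - 1) * r ^ (b - 1)) • (G s * G (r * s)))
      ((volume.restrict (Ioi (0 : ℝ))).prod (volume.restrict (Ioi (0 : ℝ)))) := by
  have hK : 0 ≤ K := by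
    have := (norm_nonneg _).trans (hG.norm_le 1 one_pos)
    linarith
  set g : ℝ × ℝ → ℝ := fun z =>
    K ^ 2 * (z.1 ^ (a + b - 1) * z.2 ^ (b - 1) * ((1 + z.1)⁻¹ * (1 + z.2 * z.1)⁻¹)) with hg
  have hgm : Measurable g := by fun_prop
  -- for fixed `s`, the scaled inner integral is that of the scalar family, up to a factor
  have hgs : ∀ s : ℝ, 0 < s → ∀ r : ℝ, 0 < r →
      g (s, r) = K ^ 2 * (s ^ (a - 1) * (1 + s)⁻¹) *
        (s * ((s * r) ^ (b - 1) * (1 + s * r)⁻¹)) := by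
    intro s hs r hr
    simp only [hg]
    rw [Real.mul_rpow hs.le hr.le, show a + b - 1 = (a - 1) + (b - 1) + 1 by ring,
      Real.rpow_add_one hs.ne', Real.rpow_add hs, mul_comm r s]
    ring
  have hgi : Integrable g
      ((volume.restrict (Ioi (0 : ℝ))).prod (volume.restrict (Ioi (0 : ℝ)))) := by
    rw [integrable_prod_iff hgm.aestronglyMeasurable]
    have hint := integrableOn_rpow_div_one_add hb hb1
    constructor
    · filter_upwards [ae_restrict_mem measurableSet_Ioi] with s hs
      have hs' : (0 : ℝ) < s := hs
      have h1 := (integrableOn_Ioi_comp_mul_left_iff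
        (fun t : ℝ => t ^ (b - 1) * (1 + t)⁻¹) 0 hs').2 (by simpa using hint)
      refine IntegrableOn.congr_fun
        ((h1.const_mul s).const_mul (K ^ 2 * (s ^ (a - 1) * (1 + s)⁻¹))) ?_ measurableSet_Ioi
      intro r hr
      exact (hgs s hs' r hr).symm
    · refine IntegrableOn.congr_fun
        (((integrableOn_rpow_div_one_add ha ha1).const_mul (K ^ 2)).mul_const
          (∫ t in Ioi (0 : ℝ), t ^ (b - 1) * (1 + t)⁻¹)) ?_
        measurableSet_Ioi
      intro s hs
      have hs' : (0 : ℝ) < s := hs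
      have h2 := integral_comp_mul_left_Ioi' (fun t : ℝ => t ^ (b - 1) * (1 + t)⁻¹) 0 hs'
      rw [mul_zero, smul_eq_mul] at h2
      simp only
      rw [← h2, ← integral_const_mul, ← integral_const_mul]
      refine setIntegral_congr_fun measurableSet_Ioi fun r hr => ?_
      have hr' : (0 : ℝ) < r := hr
      rw [hgs s hs' r hr', Real.norm_of_nonneg (by positivity)]
  have hsub : MeasurableSet (Ioi (0 : ℝ) ×ˢ Ioi (0 : ℝ)) := measurableSet_Ioi.prod measurableSet_Ioi
  refine Integrable.mono' hgi ?_ ?_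
  · rw [Measure.prod_restrict]
    refine ContinuousOn.aestronglyMeasurable ?_ hsub
    have hc1 : ContinuousOn (fun z : ℝ × ℝ => G z.1) (Ioi (0 : ℝ) ×ˢ Ioi (0 : ℝ)) :=
      hG.continuousOn.comp continuousOn_fst fun z hz => hz.1
    have hc2 : ContinuousOn (fun z : ℝ × ℝ => G (z.2 * z.1)) (Ioi (0 : ℝ) ×ˢ Ioi (0 : ℝ)) :=
      hG.continuousOn.comp (by fun_prop) fun z hz => mem_Ioi.2 (mul_pos hz.2 hz.1)
    refine ContinuousOn.smul (ContinuousOn.mul ?_ ?_) (hc1.mul hc2)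
    · exact continuousOn_fst.rpow_const fun z hz => Or.inl (ne_of_gt hz.1)
    · exact continuousOn_snd.rpow_const fun z hz => Or.inl (ne_of_gt hz.2)
  · rw [Measure.prod_restrict]
    filter_upwards [ae_restrict_mem hsub] with z hz
    have h1 : (0 : ℝ) < z.1 := hz.1
    have h2 : (0 : ℝ) < z.2 := hz.2
    simp only [Function.uncurry, hg]
    rw [norm_smul, Real.norm_of_nonneg (by positivity)]
    calc _ ≤ z.1 ^ (a + b - 1) * z.2 ^ (b - 1) * ((K * (1 + z.1)⁻¹) * (K * (1 + z.2 * z.1)⁻¹)) := by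
          refine mul_le_mul_of_nonneg_left ((norm_mul_le _ _).trans ?_) (by positivity)
          exact mul_le_mul (hG.norm_le _ h1) (hG.norm_le _ (mul_pos h2 h1)) (norm_nonneg _)
            (by positivity)
      _ = _ := by ring

/-- The product of two Balakrishnan-type integrals is a multiple of the integral for the sum of the
exponents, with a factor which does not depend on the resolvent family. -/
theorem IsResolventFamily.integral_mul_integral_eq_smul [IsScalarTower ℝ 𝔸 𝔸]
    [SMulCommClass ℝ 𝔸 𝔸] [CompleteSpace 𝔸] {G : ℝ → 𝔸} {K : ℝ}
    (hG : IsResolventFamily G K) {a b : ℝ} (ha : 0 < a) (hb : 0 < b) (hab : a + b < 1) :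
    (∫ s in Ioi (0 : ℝ), s ^ (a - 1) • G s) * (∫ t in Ioi (0 : ℝ), t ^ (b - 1) • G t) =
      (∫ r in Ioi (0 : ℝ), r ^ (b - 1) * ((r - 1)⁻¹ * (r ^ (1 - (a + b)) - 1))) •
        ∫ s in Ioi (0 : ℝ), s ^ (a + b - 1) • G s := by
  have ha1 : a < 1 := by linarith
  have hb1 : b < 1 := by linarith
  have hintb := hG.integrableOn hb hb1
  have hintab := hG.integrableOn (add_pos ha hb) hab
  calc _ = ∫ s in Ioi (0 : ℝ), (s ^ (a - 1) • G s) * (∫ t in Ioi (0 : ℝ), t ^ (b - 1) • G t) :=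
        (integral_mul_const_of_integrable (hG.integrableOn ha ha1)).symm
    _ = ∫ s in Ioi (0 : ℝ), ∫ r in Ioi (0 : ℝ),
          (s ^ (a + b - 1) * r ^ (b - 1)) • (G s * G (r * s)) := by
        refine setIntegral_congr_fun measurableSet_Ioi fun s hs => ?_
        have hs' : (0 : ℝ) < s := hs
        have h2 := integral_comp_mul_left_Ioi' (fun t : ℝ => t ^ (b - 1) • G t) 0 hs'
        rw [mul_zero] at h2
        have h3 := (integrableOn_Ioi_comp_mul_left_iff
          (fun t : ℝ => t ^ (b - 1) • G t) 0 hs').2 (by simpa using hintb)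
        have h4 : Integrable (fun r : ℝ => s • ((s * r) ^ (b - 1) • G (s * r)))
            (volume.restrict (Ioi 0)) := Integrable.smul s h3
        rw [← h2, ← integral_smul, ← integral_const_mul_of_integrable h4]
        refine setIntegral_congr_fun measurableSet_Ioi fun r hr => ?_
        have hr' : (0 : ℝ) < r := hr
        simp only [smul_mul_assoc, mul_smul_comm, smul_smul]
        rw [Real.mul_rpow hs'.le hr'.le, show a + b - 1 = (a - 1) + (b - 1) + 1 by ring,
          Real.rpow_add_one hs'.ne', Real.rpow_add hs', mul_comm r s]
        congr 1
        ring
    _ = ∫ r in Ioi (0 : ℝ), ∫ s in Ioi (0 : ℝ),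
          (s ^ (a + b - 1) * r ^ (b - 1)) • (G s * G (r * s)) :=
        integral_integral_swap (hG.integrable_prod ha ha1 hb hb1)
    _ = ∫ r in Ioi (0 : ℝ), (r ^ (b - 1) * ((r - 1)⁻¹ * (r ^ (1 - (a + b)) - 1))) •
          ∫ s in Ioi (0 : ℝ), s ^ (a + b - 1) • G s := by
        refine integral_congr_ae ?_
        have hne : ∀ᵐ r : ℝ ∂(volume.restrict (Ioi (0 : ℝ))), r ≠ 1 :=
          ae_restrict_of_ae (Measure.ae_ne volume 1)
        filter_upwards [ae_restrict_mem measurableSet_Ioi, hne] with r hr hr1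
        have hr' : (0 : ℝ) < r := hr
        have hr2 : r - 1 ≠ 0 := sub_ne_zero.2 hr1
        have h3 := (integrableOn_Ioi_comp_mul_left_iff
          (fun t : ℝ => t ^ (a + b - 1) • G t) 0 hr').2 (by simpa using hintab)
        have h4 : IntegrableOn (fun s : ℝ => s ^ (a + b - 1) • G (r * s)) (Ioi 0) := by
          refine IntegrableOn.congr_fun (h3.smul (r ^ (a + b - 1))⁻¹) ?_ measurableSet_Ioi
          intro s hs
          have : r ^ (a + b - 1) ≠ 0 := (Real.rpow_pos_of_pos hr' _).ne'
          simp only [Pi.smul_apply]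
          rw [Real.mul_rpow hr'.le (le_of_lt hs), smul_smul, inv_mul_cancel_left₀ this]
        have h5 : ∀ s ∈ Ioi (0 : ℝ), (s ^ (a + b - 1) * r ^ (b - 1)) • (G s * G (r * s)) =
            (r ^ (b - 1) * (r - 1)⁻¹) •
              (r • (s ^ (a + b - 1) • G (r * s)) - s ^ (a + b - 1) • G s) := by
          intro s hs
          have hs' : (0 : ℝ) < s := hs
          have h6 := hG.mul s (r * s) hs' (mul_pos hr' hs')
          have h7 : G s * G (r * s) = (r - 1)⁻¹ • (r • G (r * s) - G s) := by
            have h8 : (s * (r - 1)) • (G s * G (r * s)) = s • (r • G (r * s) - G s) := by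
              rw [show s * (r - 1) = r * s - s by ring, h6, smul_sub, smul_smul, mul_comm s r]
            rw [mul_smul] at h8
            have h9 := smul_right_injective 𝔸 hs'.ne' h8
            rw [← h9, inv_smul_smul₀ hr2]
          rw [h7]
          simp only [smul_sub, smul_smul]
          congr 2 <;> ring
        have h6 : Integrable (fun s : ℝ => r • (s ^ (a + b - 1) • G (r * s)))
            (volume.restrict (Ioi 0)) := Integrable.smul r h4
        rw [setIntegral_congr_fun measurableSet_Ioi h5, integral_smul,
          integral_sub h6 hintab, integral_smul, integral_rpow_smul_comp_mul G (a + b) hr',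
          smul_smul,
          ← mul_assoc, mul_smul _ (r ^ (1 - (a + b)) - 1), sub_smul, one_smul,
          sub_eq_add_neg 1 (a + b), Real.rpow_add hr', Real.rpow_one]
    _ = _ := integral_smul_const _ _

/-- The normalized Balakrishnan-type integrals form a semigroup. The factor in
`IsResolventFamily.integral_mul_integral_eq_smul` is determined by the scalar family `1 / (1 + s)`,
all of whose normalized integrals are equal to `1`. -/
theorem IsResolventFamily.integral_mul_integral [IsScalarTower ℝ 𝔸 𝔸]
    [SMulCommClass ℝ 𝔸 𝔸] [CompleteSpace 𝔸] {G : ℝ → 𝔸} {K : ℝ}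
    (hG : IsResolventFamily G K) {a b : ℝ} (ha : 0 < a) (hb : 0 < b) (hab : a + b < 1) :
    ((Real.sin (Real.pi * a) / Real.pi) • ∫ s in Ioi (0 : ℝ), s ^ (a - 1) • G s) *
        ((Real.sin (Real.pi * b) / Real.pi) • ∫ s in Ioi (0 : ℝ), s ^ (b - 1) • G s) =
      (Real.sin (Real.pi * (a + b)) / Real.pi) • ∫ s in Ioi (0 : ℝ), s ^ (a + b - 1) • G s := by
  have hsin : ∀ x : ℝ, 0 < x → x < 1 → Real.sin (Real.pi * x) ≠ 0 := fun x h0 h1 =>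
    (Real.sin_pos_of_pos_of_lt_pi (by positivity) (by nlinarith [Real.pi_pos])).ne'
  have h1 := isResolventFamily_inv_one_add.integral_mul_integral_eq_smul ha hb hab
  simp only [smul_eq_mul] at h1
  rw [integral_rpow_div_one_add ha (by linarith), integral_rpow_div_one_add hb (by linarith),
    integral_rpow_div_one_add (add_pos ha hb) hab] at h1
  have ha' := hsin a ha (by linarith)
  have hb' := hsin b hb (by linarith)
  have hab' := hsin (a + b) (add_pos ha hb) hab
  have hpi := Real.pi_ne_zero
  rw [smul_mul_smul_comm, hG.integral_mul_integral_eq_smul ha hb hab, smul_smul]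
  congr 1
  rw [← div_eq_iff (div_ne_zero hpi hab')] at h1
  rw [← h1]
  field_simp

end Banach

/-! ### Fractional powers of exponent at most one -/

section Banach

variable {𝔸 : Type*} [NormedRing 𝔸] [NormedSpace ℝ 𝔸]

theorem sin_pi_mul_div_pi_pos {q : ℝ} (hq : 0 < q) (hq1 : q < 1) :
    0 < Real.sin (Real.pi * q) / Real.pi :=
  div_pos (Real.sin_pos_of_pos_of_lt_pi (by positivity) (by nlinarith [Real.pi_pos])) Real.pi_pos

theorem sin_pi_mul_div_pi_le {q : ℝ} (hq1 : q < 1) :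
    Real.sin (Real.pi * q) / Real.pi ≤ 1 - q := by
  rw [div_le_iff₀ Real.pi_pos, ← Real.sin_pi_sub]
  refine (Real.sin_le ?_).trans_eq (by ring)
  nlinarith [Real.pi_pos]

theorem sin_pi_mul_div_pi_mul_integral {q : ℝ} (hq : 0 < q) (hq1 : q < 1) :
    Real.sin (Real.pi * q) / Real.pi * ∫ s in Ioi (0 : ℝ), s ^ (q - 1) * (1 + s)⁻¹ = 1 := by
  rw [integral_rpow_div_one_add hq hq1]
  have h := sin_pi_mul_div_pi_pos hq hq1
  have h1 : Real.sin (Real.pi * q) ≠ 0 := by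
    rintro h0
    simp [h0] at h
  field_simp

/-- The normalized integrals inherit the constant `K`, because those of `1 / (1 + s)` equal `1`. -/
theorem IsResolventFamily.norm_integral_le {G : ℝ → 𝔸} {K : ℝ} (hG : IsResolventFamily G K)
    {q : ℝ} (hq : 0 < q) (hq1 : q < 1) :
    ‖(Real.sin (Real.pi * q) / Real.pi) • ∫ s in Ioi (0 : ℝ), s ^ (q - 1) • G s‖ ≤ K := by
  have hc := sin_pi_mul_div_pi_pos hq hq1
  rw [norm_smul, Real.norm_of_nonneg hc.le]
  have h1 : ‖∫ s in Ioi (0 : ℝ), s ^ (q - 1) • G s‖ ≤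
      ∫ s in Ioi (0 : ℝ), K * (s ^ (q - 1) * (1 + s)⁻¹) := by
    refine norm_integral_le_of_norm_le ((integrableOn_rpow_div_one_add hq hq1).const_mul K) ?_
    filter_upwards [ae_restrict_mem measurableSet_Ioi] with s hs
    have hs' : (0 : ℝ) < s := hs
    rw [norm_smul, Real.norm_of_nonneg (Real.rpow_nonneg hs'.le _)]
    calc _ ≤ s ^ (q - 1) * (K * (1 + s)⁻¹) :=
          mul_le_mul_of_nonneg_left (hG.norm_le s hs') (Real.rpow_nonneg hs'.le _)
      _ = _ := by ring
  rw [integral_const_mul] at h1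
  calc _ ≤ _ := mul_le_mul_of_nonneg_left h1 hc.le
    _ = K * (Real.sin (Real.pi * q) / Real.pi * ∫ s in Ioi (0 : ℝ), s ^ (q - 1) * (1 + s)⁻¹) := by
        ring
    _ = K := by rw [sin_pi_mul_div_pi_mul_integral hq hq1, mul_one]

end Banach

section Operators

variable {𝕜 X : Type*} [RCLike 𝕜] [NormedAddCommGroup X] [NormedSpace 𝕜 X]
  [NormedSpace ℝ X] [IsScalarTower ℝ 𝕜 X]

theorem IsPositiveType.mul_resolventAt [CompleteSpace X] {A : X →L[𝕜] X}
    (hA : IsPositiveType A) {s : ℝ}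
    (hs : 0 < s) : A * resolventAt A s = 1 - s • resolventAt A s := by
  have := Ring.mul_inverse_cancel _ (hA.isUnit hs)
  rw [add_mul] at this
  rw [eq_sub_iff_add_eq, ← this]
  simp [resolventAt]

theorem IsPositiveType.resolventAt_mul [CompleteSpace X] {A : X →L[𝕜] X}
    (hA : IsPositiveType A) {s : ℝ}
    (hs : 0 < s) : resolventAt A s * A = 1 - s • resolventAt A s := by
  have := Ring.inverse_mul_cancel _ (hA.isUnit hs)
  rw [mul_add] at this
  rw [eq_sub_iff_add_eq, ← this]
  simp [resolventAt]

theorem IsPositiveType.commute_resolventAt [CompleteSpace X] {A : X →L[𝕜] X}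
    (hA : IsPositiveType A) {s : ℝ}
    (hs : 0 < s) : A * resolventAt A s = resolventAt A s * A := by
  rw [hA.mul_resolventAt hs, hA.resolventAt_mul hs]

/-- The resolvent identity `(t - s) (A + sI)⁻¹ (A + tI)⁻¹ = (A + sI)⁻¹ - (A + tI)⁻¹`. -/
theorem IsPositiveType.resolvent_identity [CompleteSpace X] {A : X →L[𝕜] X}
    (hA : IsPositiveType A) {s t : ℝ}
    (hs : 0 < s) (ht : 0 < t) :
    (t - s) • (resolventAt A s * resolventAt A t) = resolventAt A s - resolventAt A t := by
  have h1 : resolventAt A s * (A * resolventAt A t) = resolventAt A s * A * resolventAt A t :=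
    (mul_assoc _ _ _).symm
  rw [hA.mul_resolventAt ht, hA.resolventAt_mul hs, mul_sub, sub_mul, mul_one, one_mul,
    mul_smul_comm, smul_mul_assoc] at h1
  rw [sub_smul, sub_eq_sub_iff_add_eq_add]
  rw [sub_eq_sub_iff_add_eq_add] at h1
  rw [add_comm (t • _), ← h1]

theorem IsPositiveType.isResolventFamily [CompleteSpace X] {A : X →L[𝕜] X}
    (hA : IsPositiveType A) :
    ∃ K : ℝ, IsResolventFamily (fun s : ℝ => resolventAt A s * A) K := by
  obtain ⟨κ, hκ, h⟩ := id hA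
  have hone : ‖(1 : X →L[𝕜] X)‖ ≤ 1 := ContinuousLinearMap.norm_id_le
  refine ⟨(1 + κ) + κ * ‖A‖, ?_, ?_, ?_⟩
  · intro s hs
    have hs' : (0 : ℝ) < s := hs
    obtain ⟨u, hu⟩ := hA.isUnit hs'
    have h1 : ContinuousAt (fun s : ℝ => resolventAt A s) s := by
      have h2 : ContinuousAt (fun s : ℝ => A + s • (1 : X →L[𝕜] X)) s := by fun_prop
      have h3 := NormedRing.inverse_continuousAt u
      rw [hu] at h3
      exact ContinuousAt.comp (f := fun s : ℝ => A + s • (1 : X →L[𝕜] X)) h3 h2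
    exact (h1.mul continuousAt_const).continuousWithinAt
  · intro s hs
    have hb := (h s hs).2
    have h1 : ‖resolventAt A s * A‖ ≤ 1 + κ := by
      rw [hA.resolventAt_mul hs]
      refine (norm_sub_le _ _).trans (add_le_add hone ?_)
      rw [norm_smul, Real.norm_of_nonneg hs.le]
      have := mul_le_mul_of_nonneg_left hb hs.le
      rwa [mul_div_cancel₀ _ hs.ne'] at this
    have h2 : s * ‖resolventAt A s * A‖ ≤ κ * ‖A‖ := by
      have h3 := (norm_mul_le (resolventAt A s) A).trans
        (mul_le_mul_of_nonneg_right hb (norm_nonneg _))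
      calc _ ≤ s * (κ / s * ‖A‖) := mul_le_mul_of_nonneg_left h3 hs.le
        _ = κ * ‖A‖ := by field_simp
    rw [← div_eq_mul_inv, le_div_iff₀ (by positivity)]
    linarith
  · intro s t hs ht
    have h1 : resolventAt A s * A * (resolventAt A t * A) =
        A * (resolventAt A s * resolventAt A t) * A := by
      rw [← hA.commute_resolventAt hs]
      simp only [mul_assoc]
    rw [h1, ← smul_mul_assoc, ← mul_smul_comm, hA.resolvent_identity hs ht, mul_sub,
      hA.mul_resolventAt hs, hA.mul_resolventAt ht, ← smul_mul_assoc, ← smul_mul_assoc,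
      ← sub_mul]
    congr 1
    abel

theorem IsPositiveType.balakrishnan_mul [CompleteSpace X] {A : X →L[𝕜] X}
    (hA : IsPositiveType A) {a b : ℝ}
    (ha : 0 < a) (hb : 0 < b) (hab : a + b < 1) :
    balakrishnan A a * balakrishnan A b = balakrishnan A (a + b) := by
  obtain ⟨K, hK⟩ := hA.isResolventFamily
  exact hK.integral_mul_integral ha hb hab

theorem IsPositiveType.commute_balakrishnan [CompleteSpace X] {A : X →L[𝕜] X}
    (hA : IsPositiveType A) {a : ℝ}
    (ha : 0 < a) (ha1 : a < 1) : Commute A (balakrishnan A a) := by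
  have hint := hA.integrableOn ha ha1
  rw [Commute, SemiconjBy, balakrishnan, mul_smul_comm, smul_mul_assoc,
    ← integral_const_mul_of_integrable hint, ← integral_mul_const_of_integrable hint]
  congr 1
  refine setIntegral_congr_fun measurableSet_Ioi fun s hs => ?_
  rw [mul_smul_comm, smul_mul_assoc, ← mul_assoc, hA.commute_resolventAt hs]

/-- `A^q` tends to `A` in operator norm as `q ↑ 1`. Comparison with
`A = (sin πq / π) ∫₀^∞ s^(q-1) (1 + s)⁻¹ A ds` leaves an integral that stays bounded as `q ↑ 1`,
while the factor `sin πq / π` vanishes there. -/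
theorem IsPositiveType.norm_balakrishnan_sub_le [CompleteSpace X] {A : X →L[𝕜] X}
    (hA : IsPositiveType A) :
    ∃ C : ℝ, ∀ q : ℝ, 1 / 2 ≤ q → q < 1 → ‖balakrishnan A q - A‖ ≤ C * (1 - q) := by
  obtain ⟨K, hK⟩ := hA.isResolventFamily
  have hone : ‖(1 : X →L[𝕜] X)‖ ≤ 1 := ContinuousLinearMap.norm_id_le
  set I : ℝ := ∫ s in Ioi (0 : ℝ), s ^ ((1 / 2 : ℝ) - 1) * (1 + s)⁻¹ with hI
  have hI0 : 0 ≤ I := setIntegral_nonneg measurableSet_Ioi fun s hs => by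
    have : (0 : ℝ) < s := hs
    positivity
  have hK0 : 0 ≤ K := by
    have := (norm_nonneg _).trans (hK.norm_le 1 one_pos)
    linarith
  refine ⟨(1 + ‖A‖) * K * I, fun q hq hq1 => ?_⟩
  have hq0 : 0 < q := by linarith
  have hc := sin_pi_mul_div_pi_pos hq0 hq1
  have h1 := sin_pi_mul_div_pi_mul_integral hq0 hq1
  have hA1 : A = (Real.sin (Real.pi * q) / Real.pi) •
      ∫ s in Ioi (0 : ℝ), (s ^ (q - 1) * (1 + s)⁻¹) • A := by
    rw [integral_smul_const, smul_smul, h1, one_smul]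
  have hint : Integrable (fun s : ℝ => (s ^ (q - 1) * (1 + s)⁻¹) • A)
      (volume.restrict (Ioi 0)) := (integrableOn_rpow_div_one_add hq0 hq1).smul_const A
  have hsub : balakrishnan A q - A = (Real.sin (Real.pi * q) / Real.pi) •
      ∫ s in Ioi (0 : ℝ),
        (s ^ (q - 1) • (resolventAt A s * A) - (s ^ (q - 1) * (1 + s)⁻¹) • A) := by
    rw [integral_sub (hA.integrableOn hq0 hq1) hint, smul_sub, ← hA1, balakrishnan]
  have hnorm : ‖∫ s in Ioi (0 : ℝ),
        (s ^ (q - 1) • (resolventAt A s * A) - (s ^ (q - 1) * (1 + s)⁻¹) • A)‖ ≤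
      ∫ s in Ioi (0 : ℝ), ((1 + ‖A‖) * K) * (s ^ ((1 / 2 : ℝ) - 1) * (1 + s)⁻¹) := by
    refine norm_integral_le_of_norm_le
      ((integrableOn_rpow_div_one_add (by norm_num) (by norm_num)).const_mul _) ?_
    filter_upwards [ae_restrict_mem measurableSet_Ioi] with s hs
    have hs' : (0 : ℝ) < s := hs
    have hs1 : (1 + s) ≠ 0 := by positivity
    have h2 : s • (resolventAt A s * A) = A - A * (resolventAt A s * A) := by
      rw [← mul_assoc, hA.mul_resolventAt hs', sub_mul, one_mul, smul_mul_assoc,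
        sub_sub_cancel]
    have h3 : s ^ (q - 1) • (resolventAt A s * A) - (s ^ (q - 1) * (1 + s)⁻¹) • A =
        (s ^ (q - 1) * (1 + s)⁻¹) • ((1 - A) * (resolventAt A s * A)) := by
      have h4 : (1 - A) * (resolventAt A s * A) = (1 + s) • (resolventAt A s * A) - A := by
        rw [add_smul, h2, sub_mul, one_mul, one_smul]
        abel
      rw [h4, smul_sub, smul_smul, inv_mul_cancel_right₀ hs1]
    have h5 : ‖(1 - A) * (resolventAt A s * A)‖ ≤ (1 + ‖A‖) * (K * (1 + s)⁻¹) := by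
      refine (norm_mul_le _ _).trans ?_
      refine mul_le_mul ((norm_sub_le _ _).trans ?_) (hK.norm_le s hs') (norm_nonneg _)
        (by positivity)
      gcongr
    have h6 : s ^ (q - 1) * (1 + s)⁻¹ ≤ s ^ ((1 / 2 : ℝ) - 1) := by
      rcases le_total s 1 with hs2 | hs2
      · have h7 : s ^ (q - 1) ≤ s ^ ((1 / 2 : ℝ) - 1) :=
          Real.rpow_le_rpow_of_exponent_ge hs' hs2 (by linarith)
        have h8 : (1 + s)⁻¹ ≤ 1 := inv_le_one_of_one_le₀ (by linarith)
        calc _ ≤ s ^ (q - 1) * 1 :=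
              mul_le_mul_of_nonneg_left h8 (Real.rpow_nonneg hs'.le _)
          _ ≤ _ := by linarith
      · have h7 : s ^ (q - 1) ≤ 1 := Real.rpow_le_one_of_one_le_of_nonpos hs2 (by linarith)
        have h8 : (1 + s)⁻¹ ≤ s⁻¹ := inv_anti₀ hs' (by linarith)
        have h9 : s ^ (-1 : ℝ) ≤ s ^ ((1 / 2 : ℝ) - 1) :=
          Real.rpow_le_rpow_of_exponent_le hs2 (by norm_num)
        rw [Real.rpow_neg_one] at h9
        calc _ ≤ 1 * (1 + s)⁻¹ := mul_le_mul_of_nonneg_right h7 (by positivity)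
          _ ≤ _ := by linarith
    rw [h3, norm_smul, Real.norm_of_nonneg (by positivity)]
    calc _ ≤ s ^ ((1 / 2 : ℝ) - 1) * ((1 + ‖A‖) * (K * (1 + s)⁻¹)) :=
          mul_le_mul h6 h5 (norm_nonneg _) (by positivity)
      _ = _ := by ring
  rw [integral_const_mul, ← hI] at hnorm
  rw [hsub, norm_smul, Real.norm_of_nonneg hc.le]
  calc _ ≤ (1 - q) * ((1 + ‖A‖) * K * I) :=
        mul_le_mul (sin_pi_mul_div_pi_le hq1) hnorm (norm_nonneg _) (by linarith)
    _ = _ := by ring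

theorem fracPow_zero (A : X →L[𝕜] X) : fracPow A 0 = 1 := by simp [fracPow]

theorem fracPow_one (A : X →L[𝕜] X) : fracPow A 1 = A := by simp [fracPow]

theorem fracPow_eq_balakrishnan (A : X →L[𝕜] X) {t : ℝ} (ht : 0 < t) (ht1 : t < 1) :
    fracPow A t = balakrishnan A t := by
  have h1 : Int.fract t = t := Int.fract_eq_self.2 ⟨ht.le, ht1⟩
  have h2 : ⌊t⌋₊ = 0 := Nat.floor_eq_zero.2 ht1
  rw [fracPow, h1, h2, if_neg ht.ne', pow_zero, mul_one]

/-- The semigroup law, as long as the second exponent does not reach the next integer. -/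
theorem IsPositiveType.fracPow_add [CompleteSpace X] {A : X →L[𝕜] X}
    (hA : IsPositiveType A) {a h : ℝ}
    (ha : 0 ≤ a) (hh : 0 ≤ h) (hah : Int.fract a + h < 1) :
    fracPow A (a + h) = fracPow A a * fracPow A h := by
  rcases hh.eq_or_lt with rfl | hh
  · rw [add_zero, fracPow_zero, mul_one]
  have hf := Int.fract_nonneg a
  have hh1 : h < 1 := by linarith
  have hcast : ((⌊a⌋₊ : ℕ) : ℝ) + Int.fract a = a := by
    rw [natCast_floor_eq_intCast_floor ha, Int.floor_add_fract]
  have hfr : Int.fract (a + h) = Int.fract a + h := by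
    have h1 : a + h = (⌊a⌋ : ℤ) + (Int.fract a + h) := by
      rw [← add_assoc, Int.floor_add_fract]
    rw [h1, Int.fract_intCast_add, Int.fract_eq_self.2 ⟨by linarith, by linarith⟩]
  have hfl : ⌊a + h⌋₊ = ⌊a⌋₊ := by
    rw [Nat.floor_eq_iff (by linarith)]
    constructor <;> linarith
  rw [fracPow_eq_balakrishnan A hh hh1, fracPow, fracPow, hfr, hfl, if_neg (by linarith),
    mul_assoc, ((hA.commute_balakrishnan hh hh1).pow_left _).eq]
  rcases hf.eq_or_lt with h0 | h0
  · rw [← h0, if_pos rfl, one_mul, zero_add]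
  · rw [if_neg h0.ne', ← mul_assoc, hA.balakrishnan_mul h0 hh hah]

theorem IsPositiveType.exists_norm_fracPow_le [CompleteSpace X] {A : X →L[𝕜] X}
    (hA : IsPositiveType A) :
    ∃ M : ℝ, 1 ≤ M ∧ ∀ t ∈ Icc (0 : ℝ) 1, ‖fracPow A t‖ ≤ M := by
  obtain ⟨K, hK⟩ := hA.isResolventFamily
  have hK0 : 0 ≤ K := by
    have := (norm_nonneg _).trans (hK.norm_le 1 one_pos)
    linarith
  have hA0 := norm_nonneg A
  refine ⟨1 + K + ‖A‖, by linarith, fun t ht => ?_⟩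
  rcases ht.1.eq_or_lt with rfl | h0
  · rw [fracPow_zero]
    have hone : ‖(1 : X →L[𝕜] X)‖ ≤ 1 := ContinuousLinearMap.norm_id_le
    linarith
  rcases ht.2.eq_or_lt with rfl | h1
  · rw [fracPow_one]
    linarith
  · rw [fracPow_eq_balakrishnan A h0 h1]
    have : ‖balakrishnan A t‖ ≤ K := hK.norm_integral_le h0 h1
    linarith

/-! ### Orbits of the semigroup of fractional powers -/

theorem tendsto_logOp {A : X →L[𝕜] X} {x : X} (hx : x ∈ logDomain A) :
    Tendsto (fun p : ℝ => p⁻¹ • (fracPow A p x - x)) (𝓝[>] 0) (𝓝 (logOp A x)) :=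
  tendsto_nhds_limUnder hx

theorem logOp_eq {A : X →L[𝕜] X} {x y : X}
    (h : Tendsto (fun p : ℝ => p⁻¹ • (fracPow A p x - x)) (𝓝[>] 0) (𝓝 y)) : logOp A x = y :=
  h.limUnder_eq

theorem IsPositiveType.hasDerivWithinAt_fracPow [CompleteSpace X] {A : X →L[𝕜] X}
    (hA : IsPositiveType A) {x : X}
    (hx : x ∈ logDomain A) {t : ℝ} (ht : t ∈ Ico (0 : ℝ) 1) :
    HasDerivWithinAt (fun t : ℝ => fracPow A t x) (fracPow A t (logOp A x)) (Ici t) t := by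
  rw [hasDerivWithinAt_iff_tendsto_slope, Ici_sdiff_left]
  have h1 : Tendsto (fun u : ℝ => u - t) (𝓝[>] t) (𝓝[>] 0) := by
    refine tendsto_nhdsWithin_iff.2 ⟨?_, ?_⟩
    · have : Tendsto (fun u : ℝ => u - t) (𝓝 t) (𝓝 (t - t)) :=
        (continuous_id.sub continuous_const).tendsto t
      rw [sub_self] at this
      exact this.mono_left nhdsWithin_le_nhds
    · filter_upwards [self_mem_nhdsWithin] with u hu
      exact mem_Ioi.2 (sub_pos.2 (mem_Ioi.1 hu))
  refine (((fracPow A t).continuous.tendsto _).comp ((tendsto_logOp hx).comp h1)).congr' ?_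
  filter_upwards [Ioo_mem_nhdsGT ht.2] with u hu
  have hfr : Int.fract t = t := Int.fract_eq_self.2 ht
  have h2 : fracPow A u = fracPow A t * fracPow A (u - t) := by
    rw [← hA.fracPow_add ht.1 (by linarith [hu.1]) (by rw [hfr]; linarith [hu.2]), add_sub_cancel]
  have h3 : fracPow A t ((u - t)⁻¹ • (fracPow A (u - t) x - x)) =
      (u - t)⁻¹ • fracPow A t (fracPow A (u - t) x - x) :=
    map_real_smul (fracPow A t) (fracPow A t).continuous _ _
  simp only [Function.comp_apply, slope, vsub_eq_sub]
  rw [h3, h2, map_sub]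
  rfl

theorem IsPositiveType.continuousOn_fracPow [CompleteSpace X] {A : X →L[𝕜] X}
    (hA : IsPositiveType A) {x : X}
    (hx : x ∈ logDomain A) : ContinuousOn (fun t : ℝ => fracPow A t x) (Icc 0 1) := by
  obtain ⟨M, hM1, hM⟩ := hA.exists_norm_fracPow_le
  have h0 : Tendsto (fun h : ℝ => fracPow A h x) (𝓝[≥] 0) (𝓝 x) := by
    have := (hA.hasDerivWithinAt_fracPow hx ⟨le_rfl, zero_lt_one⟩).continuousWithinAt
    simpa [ContinuousWithinAt, fracPow_zero] using this
  intro t ht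
  rcases ht.2.eq_or_lt with rfl | ht1
  -- `fracPow_add` does not reach the right endpoint, where convergence in norm takes its place
  · obtain ⟨C, hC⟩ := hA.norm_balakrishnan_sub_le
    rw [ContinuousWithinAt, tendsto_iff_norm_sub_tendsto_zero]
    have hlim : Tendsto (fun q : ℝ => C * (1 - q) * ‖x‖) (𝓝[Icc 0 1] 1) (𝓝 0) := by
      have : Tendsto (fun q : ℝ => C * (1 - q) * ‖x‖) (𝓝 1) (𝓝 (C * (1 - 1) * ‖x‖)) :=
        Continuous.tendsto (by fun_prop) 1
      simp only [sub_self, mul_zero, zero_mul] at this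
      exact this.mono_left nhdsWithin_le_nhds
    refine squeeze_zero' (Eventually.of_forall fun _ => norm_nonneg _) ?_ hlim
    have hev : ∀ᶠ q : ℝ in 𝓝[Icc 0 1] 1, 1 / 2 ≤ q :=
      nhdsWithin_le_nhds (Ici_mem_nhds (by norm_num))
    filter_upwards [hev, self_mem_nhdsWithin] with q hq hq1
    rcases hq1.2.eq_or_lt with rfl | hq2
    · simp
    · rw [fracPow_one, fracPow_eq_balakrishnan A (by linarith) hq2, ← sub_apply]
      exact (ContinuousLinearMap.le_opNorm _ _).trans
        (mul_le_mul_of_nonneg_right (hC q hq hq2) (norm_nonneg _))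
  have hright := (hA.hasDerivWithinAt_fracPow hx ⟨ht.1, ht1⟩).continuousWithinAt
  have hleft : ContinuousWithinAt (fun t : ℝ => fracPow A t x) (Icc 0 t) t := by
    rw [ContinuousWithinAt, tendsto_iff_norm_sub_tendsto_zero]
    have h1 : Tendsto (fun u : ℝ => t - u) (𝓝[Icc 0 t] t) (𝓝[≥] 0) := by
      refine tendsto_nhdsWithin_iff.2 ⟨?_, ?_⟩
      · have : Tendsto (fun u : ℝ => t - u) (𝓝 t) (𝓝 (t - t)) :=
          (continuous_const.sub continuous_id).tendsto t
        rw [sub_self] at this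
        exact this.mono_left nhdsWithin_le_nhds
      · filter_upwards [self_mem_nhdsWithin] with u hu
        exact sub_nonneg.2 hu.2
    have hlim : Tendsto (fun u : ℝ => M * ‖fracPow A (t - u) x - x‖) (𝓝[Icc 0 t] t) (𝓝 0) := by
      have := (tendsto_iff_norm_sub_tendsto_zero.1 (h0.comp h1)).const_mul M
      rwa [mul_zero] at this
    refine squeeze_zero' (Eventually.of_forall fun _ => norm_nonneg _) ?_ hlim
    filter_upwards [self_mem_nhdsWithin] with u hu
    have hu1 : u < 1 := hu.2.trans_lt ht1
    have hfr : Int.fract u = u := Int.fract_eq_self.2 ⟨hu.1, hu1⟩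
    have h2 : fracPow A t = fracPow A u * fracPow A (t - u) := by
      rw [← hA.fracPow_add hu.1 (by linarith [hu.2]) (by rw [hfr]; linarith), add_sub_cancel]
    rw [norm_sub_rev, h2, mul_apply_eq_comp, ← map_sub]
    exact (ContinuousLinearMap.le_opNorm _ _).trans
      (mul_le_mul_of_nonneg_right (hM u ⟨hu.1, hu1.le⟩) (norm_nonneg _))
  refine (hleft.union hright).mono fun u hu => ?_
  rcases le_total u t with h | h
  · exact Or.inl ⟨hu.1, h⟩
  · exact Or.inr h

/-! ### Domains of the powers of the logarithm -/

theorem tendsto_smul_sub (A : X →L[𝕜] X) (c : ℝ) {x y : X} (hx : x ∈ logDomain A)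
    (hy : y ∈ logDomain A) :
    Tendsto (fun p : ℝ => p⁻¹ • (fracPow A p (c • x - y) - (c • x - y))) (𝓝[>] 0)
      (𝓝 (c • logOp A x - logOp A y)) := by
  refine (((tendsto_logOp hx).const_smul c).sub (tendsto_logOp hy)).congr fun p => ?_
  have h : fracPow A p (c • x) = c • fracPow A p x :=
    map_real_smul (fracPow A p) (fracPow A p).continuous _ _
  rw [map_sub, h]
  simp only [smul_sub, smul_comm c p⁻¹]
  abel

theorem smul_sub_mem_logPowDomain (A : X →L[𝕜] X) (c : ℝ) (n : ℕ) :
    ∀ {x y : X}, x ∈ logPowDomain A n → y ∈ logPowDomain A n → c • x - y ∈ logPowDomain A n := by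
  induction n with
  | zero => intro x y _ _; trivial
  | succ n ih =>
    intro x y hx hy
    have h := tendsto_smul_sub A c hx.1 hy.1
    refine ⟨⟨_, h⟩, ?_⟩
    rw [logOp_eq h]
    exact ih hx.2 hy.2

theorem logPowDomain_succ_subset (A : X →L[𝕜] X) (n : ℕ) :
    logPowDomain A (n + 1) ⊆ logPowDomain A n := by
  induction n with
  | zero => intro x _; trivial
  | succ n ih => exact fun x hx => ⟨hx.1, ih hx.2⟩

theorem smul_sub_logOp_mem {A : X →L[𝕜] X} {n : ℕ} {v : X} (hv : v ∈ logPowDomain A (n + 1))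
    (μ : ℝ) : μ • v - logOp A v ∈ logPowDomain A n :=
  smul_sub_mem_logPowDomain A μ n (logPowDomain_succ_subset A n hv) hv.2

theorem sourceElement_succ (A : X →L[𝕜] X) (μ : ℝ) (n : ℕ) (v : X) :
    sourceElement A μ (n + 1) v = sourceElement A μ n (μ • v - logOp A v) := rfl

/-! ### Smoothing estimates in terms of the source element -/

/-- An estimate form of the variation of constants formula
`e^(-μs) A^s x = e^(-μT) A^T x + ∫_s^T e^(-μt) A^t (μI - log A) x dt`: the right derivative of
`t ↦ e^(-μt) A^t x` is `-e^(-μt) A^t (μI - log A) x`. -/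
theorem IsPositiveType.norm_fracPow_apply_le [CompleteSpace X] {A : X →L[𝕜] X}
    (hA : IsPositiveType A) (B : X →L[𝕜] X) {x : X} (hx : x ∈ logDomain A) (μ : ℝ) {s T : ℝ}
    (hs : 0 ≤ s) (hsT : s ≤ T) (hT : T ≤ 1) {Φ Φ' : ℝ → ℝ} (hΦ : ∀ t, HasDerivAt Φ (Φ' t) t)
    (hbound : ∀ t ∈ Ico s T,
      Real.exp (-μ * t) * ‖B (fracPow A t (μ • x - logOp A x))‖ ≤ Φ' t) :
    Real.exp (-μ * s) * ‖B (fracPow A s x)‖ ≤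
      Real.exp (-μ * T) * ‖B (fracPow A T x)‖ + (Φ T - Φ s) := by
  set g : ℝ → X := fun t => Real.exp (-μ * t) • B (fracPow A t x) with hg
  have hcont : ContinuousOn g (Icc s T) := by
    refine ContinuousOn.smul (by fun_prop) (B.continuous.comp_continuousOn ?_)
    exact (hA.continuousOn_fracPow hx).mono (Icc_subset_Icc hs hT)
  have hder : ∀ t ∈ Ico s T, HasDerivWithinAt g
      (-(Real.exp (-μ * t) • B (fracPow A t (μ • x - logOp A x)))) (Ici t) t := by
    intro t ht
    have h1 := hA.hasDerivWithinAt_fracPow hx (t := t) ⟨hs.trans ht.1, ht.2.trans_le hT⟩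
    have h2 : HasDerivWithinAt (fun t : ℝ => B (fracPow A t x))
        (B (fracPow A t (logOp A x))) (Ici t) t := by
      exact (B.restrictScalars ℝ).hasFDerivAt.comp_hasDerivWithinAt t h1
    have h3 : HasDerivAt (fun t : ℝ => Real.exp (-μ * t)) (Real.exp (-μ * t) * (-μ * 1)) t :=
      ((hasDerivAt_id t).const_mul (-μ)).exp
    convert! h3.hasDerivWithinAt.smul h2 using 1
    have h4 : B (fracPow A t (μ • x)) = μ • B (fracPow A t x) :=
      map_real_smul (B * fracPow A t) (B * fracPow A t).continuous _ _
    rw [map_sub, map_sub, h4]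
    simp only [smul_sub, smul_smul, mul_one, mul_neg, neg_smul]
    abel
  have key := image_norm_le_of_norm_deriv_right_le_deriv_boundary
    (f := fun t => g t - g s) (hcont.sub continuousOn_const)
    (fun t ht => (hder t ht).sub_const (g s)) (B := fun t => Φ t - Φ s) (by simp)
    (fun t => (hΦ t).sub_const (Φ s))
    (fun t ht => by
      rw [norm_neg, norm_smul, Real.norm_of_nonneg (Real.exp_pos _).le]
      exact hbound t ht) (right_mem_Icc.2 hsT)
  have hnorm : ∀ t, ‖g t‖ = Real.exp (-μ * t) * ‖B (fracPow A t x)‖ := fun t => by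
    rw [hg, norm_smul, Real.norm_of_nonneg (Real.exp_pos _).le]
  rw [← hnorm, ← hnorm]
  have h5 := norm_sub_norm_le (g s) (g T)
  rw [norm_sub_rev] at h5
  linarith

theorem exp_neg_mul_le {μ t : ℝ} (ht : t ∈ Icc (0 : ℝ) 1) : Real.exp (-μ * t) ≤ Real.exp |μ| := by
  refine Real.exp_le_exp.2 ?_
  calc -μ * t ≤ |μ| * t := mul_le_mul_of_nonneg_right (neg_le_abs μ) ht.1
    _ ≤ |μ| * 1 := mul_le_mul_of_nonneg_left ht.2 (abs_nonneg _)
    _ = |μ| := mul_one _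

/-- For `μ > log ‖A‖` the operator `μI - log A` is bounded below. -/
theorem IsPositiveType.exists_norm_le_mul_norm_smul_sub_logOp [CompleteSpace X] {A : X →L[𝕜] X}
    (hA : IsPositiveType A) {μ : ℝ} (hμ : ‖A‖ < Real.exp μ) :
    ∃ K : ℝ, 0 ≤ K ∧ ∀ x ∈ logDomain A, ‖x‖ ≤ K * ‖μ • x - logOp A x‖ := by
  obtain ⟨M, hM1, hM⟩ := hA.exists_norm_fracPow_le
  have hθ : Real.exp (-μ) * ‖A‖ < 1 := by
    rw [Real.exp_neg, inv_mul_lt_iff₀ (Real.exp_pos μ), mul_one]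
    exact hμ
  have hθ' : 0 < 1 - Real.exp (-μ) * ‖A‖ := by linarith
  refine ⟨Real.exp |μ| * M / (1 - Real.exp (-μ) * ‖A‖), by positivity, fun x hx => ?_⟩
  set w := μ • x - logOp A x with hw
  have h := hA.norm_fracPow_apply_le 1 hx μ le_rfl zero_le_one le_rfl
    (Φ := fun t => t * (Real.exp |μ| * (M * ‖w‖))) (Φ' := fun _ => 1 * (Real.exp |μ| * (M * ‖w‖)))
    (fun t => (hasDerivAt_id t).mul_const _)
    (fun t ht => by
      rw [one_mul]
      have ht' : t ∈ Icc (0 : ℝ) 1 := ⟨ht.1, ht.2.le⟩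
      refine mul_le_mul (exp_neg_mul_le ht') ?_ (norm_nonneg _) (Real.exp_pos _).le
      exact ((fracPow A t).le_opNorm w).trans
        (mul_le_mul_of_nonneg_right (hM t ht') (norm_nonneg _)))
  simp only [mul_zero, Real.exp_zero, one_mul, one_apply_eq_self, fracPow_zero,
    fracPow_one, mul_one, zero_mul, sub_zero] at h
  have h2 : Real.exp (-μ) * ‖A x‖ ≤ Real.exp (-μ) * ‖A‖ * ‖x‖ := by
    rw [mul_assoc]
    exact mul_le_mul_of_nonneg_left (A.le_opNorm x) (Real.exp_pos _).le
  rw [div_mul_eq_mul_div, le_div_iff₀ hθ']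
  linarith

theorem IsPositiveType.exists_norm_le_mul_norm_sourceElement [CompleteSpace X] {A : X →L[𝕜] X}
    (hA : IsPositiveType A) {μ : ℝ} (hμ : ‖A‖ < Real.exp μ) (n : ℕ) :
    ∃ K : ℝ, 0 ≤ K ∧ ∀ v ∈ logPowDomain A n, ‖v‖ ≤ K * ‖sourceElement A μ n v‖ := by
  obtain ⟨K, hK0, hK⟩ := hA.exists_norm_le_mul_norm_smul_sub_logOp hμ
  induction n with
  | zero => exact ⟨1, zero_le_one, fun v _ => by simp [sourceElement]⟩
  | succ n ih =>
    obtain ⟨K', hK'0, hK'⟩ := ih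
    refine ⟨K * K', by positivity, fun v hv => (hK v hv.1).trans ?_⟩
    rw [sourceElement_succ, mul_assoc]
    exact mul_le_mul_of_nonneg_left (hK' _ (smul_sub_logOp_mem hv μ)) hK0

/-- If `‖B A^t‖` decays like `e^(-Lt)` for `0 ≤ t ≤ T`, then each application of
`(μI - log A)⁻¹` gains a factor `1 / L`, up to a term of the order `e^(-LT)` that stems from the
truncation at `T`. The constant depends neither on `B` nor on `L`. -/
theorem IsPositiveType.exists_norm_le_of_exp_decay [CompleteSpace X] {A : X →L[𝕜] X}
    (hA : IsPositiveType A) {μ : ℝ} (hμ : ‖A‖ < Real.exp μ) {T : ℝ} (hT0 : 0 ≤ T) (hT : T ≤ 1)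
    (n : ℕ) :
    ∃ C : ℝ, 0 ≤ C ∧ ∀ (B : X →L[𝕜] X) (b L : ℝ), 0 ≤ b → 0 < L →
      (∀ t ∈ Icc 0 T, ‖B * fracPow A t‖ ≤ b * Real.exp (-L * t)) →
      ∀ v ∈ logPowDomain A n, ∀ s ∈ Icc 0 T, ‖B (fracPow A s v)‖ ≤
        C * b * ‖sourceElement A μ n v‖ * (Real.exp (-L * s) * (L ^ n)⁻¹ + Real.exp (-L * T)) := by
  have hop : ∀ (B : X →L[𝕜] X) (t β : ℝ) (x : X), ‖B * fracPow A t‖ ≤ β →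
      ‖B (fracPow A t x)‖ ≤ β * ‖x‖ := fun B t β x h =>
    ((B * fracPow A t).le_opNorm x).trans (mul_le_mul_of_nonneg_right h (norm_nonneg _))
  induction n with
  | zero =>
    refine ⟨1, zero_le_one, fun B b L hb hL hB v _ s hs => ?_⟩
    have h1 := hop B s _ v (hB s hs)
    have h2 : 0 ≤ b * ‖v‖ * Real.exp (-L * T) := by positivity
    simp only [sourceElement, Function.iterate_zero, id, pow_zero, inv_one, mul_one, one_mul]
    linarith
  | succ n ih =>
    obtain ⟨C, hC0, hC⟩ := ih
    obtain ⟨K, hK0, hK⟩ := hA.exists_norm_le_mul_norm_sourceElement hμ (n + 1)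
    set E := Real.exp |μ| with hE
    have hE0 : 0 < E := Real.exp_pos _
    refine ⟨E * (E * K + E * C), by positivity, fun B b L hb hL hB v hv s hs => ?_⟩
    have hv1 := smul_sub_logOp_mem hv μ
    have hKv := hK v hv
    rw [sourceElement_succ] at hKv ⊢
    set N := ‖sourceElement A μ n (μ • v - logOp A v)‖ with hN
    have hN0 : 0 ≤ N := norm_nonneg _
    have hΦ : ∀ t : ℝ, HasDerivAt
        (fun t : ℝ => E * (C * b * N) * (-(Real.exp (-L * t) * (L ^ (n + 1))⁻¹) +
          t * Real.exp (-L * T)))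
        (E * (C * b * N) * (Real.exp (-L * t) * (L ^ n)⁻¹ + Real.exp (-L * T))) t := by
      intro t
      have h3 : HasDerivAt (fun t : ℝ => Real.exp (-L * t)) (Real.exp (-L * t) * (-L * 1)) t :=
        ((hasDerivAt_id t).const_mul (-L)).exp
      convert! (((h3.mul_const _).neg.add ((hasDerivAt_id t).mul_const _)).const_mul _) using 1
      field_simp
      ring
    have h := hA.norm_fracPow_apply_le B hv.1 μ hs.1 hs.2 hT hΦ (fun t ht => by
      have h1 := hC B b L hb hL hB _ hv1 t ⟨hs.1.trans ht.1, ht.2.le⟩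
      rw [mul_assoc E]
      exact mul_le_mul (exp_neg_mul_le ⟨hs.1.trans ht.1, ht.2.le.trans hT⟩) h1 (norm_nonneg _)
        hE0.le)
    have h1 : Real.exp (-μ * T) * ‖B (fracPow A T v)‖ ≤ E * (b * Real.exp (-L * T) * (K * N)) := by
      refine mul_le_mul (exp_neg_mul_le ⟨hT0, hT⟩) ?_ (norm_nonneg _) hE0.le
      exact (hop B T _ v (hB T ⟨hT0, le_rfl⟩)).trans
        (mul_le_mul_of_nonneg_left hKv (by positivity))
    have h2 : ‖B (fracPow A s v)‖ ≤ E * (Real.exp (-μ * s) * ‖B (fracPow A s v)‖) := by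
      rw [← mul_assoc]
      refine le_mul_of_one_le_left (norm_nonneg _) ?_
      rw [hE, ← Real.exp_add]
      refine Real.one_le_exp ?_
      have h3 := exp_neg_mul_le (μ := -μ) (t := s) ⟨hs.1, hs.2.trans hT⟩
      rw [Real.exp_le_exp, abs_neg] at h3
      linarith
    have hs1 : 0 ≤ 1 - (T - s) := by linarith [hs.1]
    set P := Real.exp (-L * s) * (L ^ (n + 1))⁻¹ with hP
    set Q := Real.exp (-L * T) with hQ
    set P' := Q * (L ^ (n + 1))⁻¹ with hP'
    have hP0 : 0 ≤ P := by positivity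
    have hQ0 : 0 ≤ Q := by positivity
    have hP'0 : 0 ≤ P' := by positivity
    refine h2.trans ?_
    rw [mul_assoc E, mul_assoc E, mul_assoc E]
    refine mul_le_mul_of_nonneg_left (h.trans ?_) hE0.le
    have h4 : 0 ≤ E * (b * K * N) * P := by positivity
    have h5 : 0 ≤ E * (C * b * N) * (P' + Q * (1 - (T - s))) := by positivity
    calc _ ≤ E * (b * Q * (K * N)) + _ := add_le_add_left h1 _
      _ = (E * K + E * C) * b * N * (P + Q) - E * (b * K * N) * P
            - E * (C * b * N) * (P' + Q * (1 - (T - s))) := by ring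
      _ ≤ _ := by linarith

/-! ### Companion operators on source elements -/

theorem IsRegularization.exists_norm_companion_mul_le {A : X →L[𝕜] X} {R : ℝ → X →L[𝕜] X}
    {p₀ : ℝ≥0∞} (hR : IsRegularization A R p₀) {P : ℝ} (hP : ENNReal.ofReal P ≤ p₀) :
    ∃ E : ℝ, 0 ≤ E ∧ ∀ q ∈ Icc 0 P, ∀ α : ℝ, 0 < α →
      ‖companion A R α * fracPow A q‖ ≤ E * α ^ q := by
  obtain ⟨e, he, hdecay⟩ := hR.decay
  obtain ⟨B, hB⟩ := he P
  refine ⟨max B 0, le_max_right _ _, fun q hq α hα => ?_⟩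
  have hq0 : ENNReal.ofReal q ≤ p₀ := (ENNReal.ofReal_le_ofReal hq.2).trans hP
  refine (hdecay q hq.1 hq0 α hα).trans
    (mul_le_mul_of_nonneg_right ?_ (Real.rpow_nonneg hα.le _))
  exact (hB q hq.1 hq.2 hq0).trans (le_max_left _ _)

/-- On mixed source elements `A^p v` the companion operators decay like `α^p` uniformly in `α`,
and with an additional logarithmic factor for `α < 1`. -/
theorem IsPositiveType.exists_norm_companion_le [CompleteSpace X] {A : X →L[𝕜] X}
    (hA : IsPositiveType A) {R : ℝ → X →L[𝕜] X} {p₀ : ℝ≥0∞} (hR : IsRegularization A R p₀)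
    {p : ℝ} (hp : 0 ≤ p) (hpp₀ : ENNReal.ofReal p < p₀) {μ : ℝ} (hμ : ‖A‖ < Real.exp μ) (ν : ℕ) :
    ∃ D : ℝ, 0 ≤ D ∧ ∀ v ∈ logPowDomain A ν, ∀ α : ℝ, 0 < α →
      ‖companion A R α (fracPow A p v)‖ ≤ D * α ^ p * ‖sourceElement A μ ν v‖ ∧
      (α < 1 → ‖companion A R α (fracPow A p v)‖ ≤
        D * α ^ p * ‖sourceElement A μ ν v‖ * ((-Real.log α) ^ ν)⁻¹) := by
  obtain ⟨r, hr, hr0⟩ := ENNReal.lt_iff_exists_nnreal_btwn.1 hpp₀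
  have hpr : p < r := (ENNReal.ofReal_lt_coe_iff hp).1 hr
  have hfr := Int.fract_lt_one p
  have hfr0 := Int.fract_nonneg p
  -- the semigroup law is only used up to the next integer, and the decay only up to saturation
  set T : ℝ := min (r - p) ((1 - Int.fract p) / 2) with hT
  have hT0 : 0 < T := lt_min (by linarith) (by linarith)
  have hT1 : T ≤ (1 - Int.fract p) / 2 := min_le_right _ _
  have hT2 : p + T ≤ r := by linarith [min_le_left ((r : ℝ) - p) ((1 - Int.fract p) / 2)]
  have hT3 : ENNReal.ofReal (p + T) ≤ p₀ :=
    ((ENNReal.ofReal_le_ofReal hT2).trans_eq (ENNReal.ofReal_coe_nnreal)).trans hr0.le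
  obtain ⟨E, hE0, hE⟩ := hR.exists_norm_companion_mul_le hT3
  obtain ⟨K, hK0, hK⟩ := hA.exists_norm_le_mul_norm_sourceElement hμ ν
  obtain ⟨C, hC0, hC⟩ := hA.exists_norm_le_of_exp_decay hμ hT0.le (by linarith) ν
  set F : ℝ := 1 + (Nat.factorial ν : ℝ) / T ^ ν with hF
  have hF0 : 0 < F := by positivity
  refine ⟨E * K + C * E * F, by positivity, fun v hv α hα => ⟨?_, fun hα1 => ?_⟩⟩
  · have h1 : ‖companion A R α (fracPow A p v)‖ ≤ E * α ^ p * ‖v‖ :=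
      ((companion A R α * fracPow A p).le_opNorm v).trans
        (mul_le_mul_of_nonneg_right (hE p ⟨hp, by linarith⟩ α hα) (norm_nonneg _))
    have h2 : E * α ^ p * ‖v‖ ≤ E * α ^ p * (K * ‖sourceElement A μ ν v‖) :=
      mul_le_mul_of_nonneg_left (hK v hv) (by positivity)
    have h3 : 0 ≤ C * E * F * α ^ p * ‖sourceElement A μ ν v‖ := by positivity
    calc _ ≤ E * α ^ p * (K * ‖sourceElement A μ ν v‖) := h1.trans h2
      _ ≤ E * α ^ p * (K * ‖sourceElement A μ ν v‖) +
          C * E * F * α ^ p * ‖sourceElement A μ ν v‖ := by linarith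
      _ = _ := by ring
  · set L : ℝ := -Real.log α with hL
    have hL0 : 0 < L := by linarith [Real.log_neg hα hα1]
    have hdec : ∀ t ∈ Icc 0 T, ‖companion A R α * fracPow A p * fracPow A t‖ ≤
        E * α ^ p * Real.exp (-L * t) := by
      intro t ht
      rw [mul_assoc, ← hA.fracPow_add hp ht.1 (by linarith [ht.2])]
      refine (hE (p + t) ⟨by linarith [ht.1], by linarith [ht.2]⟩ α hα).trans_eq ?_
      rw [Real.rpow_add hα, Real.rpow_def_of_pos hα t, hL, neg_neg, mul_assoc]
    have h1 := hC _ (E * α ^ p) L (by positivity) hL0 hdec v hv 0 ⟨le_rfl, hT0.le⟩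
    rw [fracPow_zero, mul_zero, Real.exp_zero, one_mul] at h1
    have h2 : Real.exp (-L * T) ≤ (Nat.factorial ν : ℝ) / T ^ ν * (L ^ ν)⁻¹ := by
      have h3 := Real.pow_div_factorial_le_exp (L * T) (by positivity) ν
      rw [neg_mul, Real.exp_neg]
      refine (inv_anti₀ (by positivity) h3).trans_eq ?_
      rw [mul_pow]
      field_simp
    have h4 : 0 ≤ E * K * α ^ p * ‖sourceElement A μ ν v‖ * (L ^ ν)⁻¹ := by positivity
    calc _ ≤ _ := h1
      _ ≤ C * (E * α ^ p) * ‖sourceElement A μ ν v‖ *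
          ((L ^ ν)⁻¹ + (Nat.factorial ν : ℝ) / T ^ ν * (L ^ ν)⁻¹) :=
        mul_le_mul_of_nonneg_left (by linarith) (by positivity)
      _ = C * E * F * α ^ p * ‖sourceElement A μ ν v‖ * (L ^ ν)⁻¹ := by rw [hF]; ring
      _ ≤ C * E * F * α ^ p * ‖sourceElement A μ ν v‖ * (L ^ ν)⁻¹ +
          E * K * α ^ p * ‖sourceElement A μ ν v‖ * (L ^ ν)⁻¹ := by linarith
      _ = _ := by ring

/-! ### The a priori parameter choice -/

theorem neg_log_aprioriParam {c p : ℝ} (hc : 0 < c) (ν : ℕ) {δ : ℝ} (hδ : 0 < δ) (hδ1 : δ < 1) :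
    -Real.log (aprioriParam c p ν δ) = Real.log (1 / δ) / (p + 1) -
      (Real.log c + (ν : ℝ) / (p + 1) * Real.log (Real.log (1 / δ))) := by
  have hℓ : 0 < Real.log (1 / δ) := Real.log_pos (by rw [lt_div_iff₀ hδ]; linarith)
  have hδp := Real.rpow_pos_of_pos hδ (1 / (p + 1))
  have hℓp := Real.rpow_pos_of_pos hℓ ((ν : ℝ) / (p + 1))
  rw [aprioriParam, Real.log_mul (by positivity) hℓp.ne', Real.log_mul hc.ne' hδp.ne',
    Real.log_rpow hδ, Real.log_rpow hℓ]
  have : Real.log δ = -Real.log (1 / δ) := by rw [one_div, Real.log_inv, neg_neg]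
  rw [this]
  ring

/-- For small noise levels, `log (1 / α_δ)` is at least of the order of `log (1 / δ)`. -/
theorem exists_le_neg_log_aprioriParam {c p : ℝ} (hc : 0 < c) (hp : 0 ≤ p) (ν : ℕ) :
    ∃ ℓ₁ : ℝ, 0 < ℓ₁ ∧ ∀ δ : ℝ, 0 < δ → δ < 1 → ℓ₁ ≤ Real.log (1 / δ) →
      Real.log (1 / δ) / (2 * (p + 1)) ≤ -Real.log (aprioriParam c p ν δ) := by
  have ho : (fun ℓ : ℝ => Real.log c + (ν : ℝ) / (p + 1) * Real.log ℓ) =o[atTop] (id : ℝ → ℝ) :=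
    (Asymptotics.isLittleO_const_id_atTop _).add (Real.isLittleO_log_id_atTop.const_mul_left _)
  have hev := ho.bound (show 0 < 1 / (2 * (p + 1)) by positivity)
  obtain ⟨ℓ₁, hℓ₁⟩ := (hev.and (eventually_gt_atTop 0)).exists_forall_of_atTop
  refine ⟨ℓ₁, (hℓ₁ ℓ₁ le_rfl).2, fun δ hδ hδ1 hℓ => ?_⟩
  obtain ⟨h1, h2⟩ := hℓ₁ _ hℓ
  rw [neg_log_aprioriParam hc ν hδ hδ1]
  rw [id, Real.norm_of_nonneg h2.le] at h1
  have h3 := (le_abs_self _).trans h1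
  have h4 : Real.log (1 / δ) / (p + 1) = Real.log (1 / δ) / (2 * (p + 1)) +
      1 / (2 * (p + 1)) * Real.log (1 / δ) := by
    field_simp
    ring
  linarith

/-- The size of the approximation error under the parameter choice. -/
theorem aprioriParam_rpow_mul {c p : ℝ} (hc : 0 < c) (hp : 0 ≤ p) (ν : ℕ) {δ : ℝ} (hδ : 0 < δ)
    (hδ1 : δ < 1) :
    aprioriParam c p ν δ ^ p * (Real.log (1 / δ) ^ ν)⁻¹ =
      c ^ p * (δ ^ (p / (p + 1)) * Real.log (1 / δ) ^ (-((ν : ℝ) / (p + 1)))) := by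
  have hℓ : 0 < Real.log (1 / δ) := Real.log_pos (by rw [lt_div_iff₀ hδ]; linarith)
  have hp1 : p + 1 ≠ 0 := by positivity
  rw [aprioriParam, Real.mul_rpow (by positivity) (by positivity),
    Real.mul_rpow hc.le (by positivity), ← Real.rpow_mul hδ.le, ← Real.rpow_mul hℓ.le,
    ← Real.rpow_natCast, ← Real.rpow_neg hℓ.le, mul_assoc, mul_assoc, ← Real.rpow_add hℓ]
  have h1 : 1 / (p + 1) * p = p / (p + 1) := by ring
  have h2 : (ν : ℝ) / (p + 1) * p + -(ν : ℝ) = -((ν : ℝ) / (p + 1)) := by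
    field_simp
    ring
  rw [h1, h2]

/-- The size of the propagated data error under the parameter choice. -/
theorem div_aprioriParam {c p : ℝ} (hp : 0 ≤ p) (ν : ℕ) {δ : ℝ} (hδ : 0 < δ)
    (hδ1 : δ < 1) :
    δ / aprioriParam c p ν δ =
      c⁻¹ * (δ ^ (p / (p + 1)) * Real.log (1 / δ) ^ (-((ν : ℝ) / (p + 1)))) := by
  have hℓ : 0 < Real.log (1 / δ) := Real.log_pos (by rw [lt_div_iff₀ hδ]; linarith)
  have hp1 : p + 1 ≠ 0 := by positivity
  have h1 : p / (p + 1) = 1 - 1 / (p + 1) := by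
    field_simp
    ring
  rw [aprioriParam, h1, Real.rpow_sub hδ, Real.rpow_one, Real.rpow_neg hℓ.le]
  simp only [div_eq_mul_inv, mul_inv]
  ring

end Operators

end LogSource

theorem mainTheorem2 {𝕜 X : Type*} [RCLike 𝕜] [NormedAddCommGroup X] [NormedSpace 𝕜 X]
    [NormedSpace ℝ X] [IsScalarTower ℝ 𝕜 X] [CompleteSpace X]
    (A : X →L[𝕜] X) (hA : LogSource.IsPositiveType A)
    (hinj : Function.Injective A) (hunb : ¬ ∃ K : ℝ, ∀ x : X, ‖x‖ ≤ K * ‖A x‖)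
    (R : ℝ → X →L[𝕜] X) (p₀ : ℝ≥0∞) (hp₀ : 0 < p₀) (hR : LogSource.IsRegularization A R p₀)
    (p : ℝ) (hp : 0 ≤ p) (hpp₀ : ENNReal.ofReal p < p₀) (ν : ℕ) (hν : 1 ≤ ν)
    (μ : ℝ) (hμ : Real.log ‖A‖ < μ)
    (c : ℝ) (hc : 0 < c) (δ₀ : ℝ) (hδ₀ : 0 < δ₀) (hδ₀' : δ₀ < 1) :
    ∃ C : ℝ, 0 < C ∧
      ∀ ubar udag fdag v : X, A udag = fdag →
        v ∈ LogSource.logPowDomain A ν → ubar - udag = LogSource.fracPow A p v →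
        ∀ δ : ℝ, 0 < δ → δ ≤ δ₀ → ∀ fδ : X, ‖fdag - fδ‖ ≤ δ →
          ‖LogSource.regElement A R ubar fδ (LogSource.aprioriParam c p ν δ) - udag‖ ≤
            C * max ‖LogSource.sourceElement A μ ν v‖ 1 *
              (δ ^ (p / (p + 1)) * Real.log (1 / δ) ^ (-((ν : ℝ) / (p + 1)))) := by
  -- if `A = 0`, then `X = 0` by injectivity, and `A⁻¹` would be bounded
  have hA0 : 0 < ‖A‖ := by
    refine norm_pos_iff.2 fun h0 => hunb ⟨0, fun x => ?_⟩
    have hx : x = 0 := hinj (by simp [h0])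
    simp [hx]
  have hμ' : ‖A‖ < Real.exp μ := (Real.log_lt_iff_lt_exp hA0).1 hμ
  obtain ⟨cs, hcs⟩ := hR.growth
  have hcs0 : 0 ≤ cs := by
    have := (norm_nonneg _).trans (hcs 1 one_pos)
    rwa [div_one] at this
  obtain ⟨D, hD0, hD⟩ := hA.exists_norm_companion_le hR hp hpp₀ hμ' ν
  obtain ⟨ℓ₁, hℓ₁, hlog⟩ := LogSource.exists_le_neg_log_aprioriParam hc hp ν
  -- the first summand of `H` serves `ℓ₁ ≤ log (1 / δ)`, where the logarithmic gain is available,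
  -- the second one the remaining bounded range of `log (1 / δ)`
  set H : ℝ := (2 * (p + 1)) ^ ν + ℓ₁ ^ ν with hH
  refine ⟨D * H * c ^ p + cs * c⁻¹ + 1, by positivity, ?_⟩
  intro ubar udag fdag v hf hv hsrc δ hδ hδδ₀ fδ hfδ
  have hδ1 : δ < 1 := hδδ₀.trans_lt hδ₀'
  set α := LogSource.aprioriParam c p ν δ with hα
  set ℓ := Real.log (1 / δ) with hℓdef
  have hℓ : 0 < ℓ := Real.log_pos (by rw [lt_div_iff₀ hδ]; linarith)
  have hα0 : 0 < α := by
    have h1 := Real.rpow_pos_of_pos hδ (1 / (p + 1))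
    have h2 := Real.rpow_pos_of_pos hℓ ((ν : ℝ) / (p + 1))
    exact mul_pos (mul_pos hc h1) h2
  set ρ : ℝ := δ ^ (p / (p + 1)) * ℓ ^ (-((ν : ℝ) / (p + 1))) with hρ
  have hρ0 : 0 ≤ ρ := by positivity
  set W := ‖LogSource.sourceElement A μ ν v‖ with hW
  have hW0 : 0 ≤ W := norm_nonneg _
  have hsplit : LogSource.regElement A R ubar fδ α - udag =
      LogSource.companion A R α (LogSource.fracPow A p v) - R α (fdag - fδ) := by
    have h1 : A ubar - fδ = A (ubar - udag) + (fdag - fδ) := by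
      rw [map_sub, hf]
      abel
    rw [LogSource.regElement, h1, map_add, ← hsrc, LogSource.companion]
    change _ = (ubar - udag) - R α (A (ubar - udag)) - _
    abel
  have hdata : ‖R α (fdag - fδ)‖ ≤ cs * c⁻¹ * ρ := by
    have h1 : ‖R α (fdag - fδ)‖ ≤ cs / α * δ :=
      ((R α).le_opNorm _).trans
        (mul_le_mul (hcs α hα0) hfδ (norm_nonneg _) (by positivity))
    refine h1.trans_eq ?_
    rw [div_mul_eq_mul_div, mul_div_assoc, hα, LogSource.div_aprioriParam hp ν hδ hδ1, ← mul_assoc]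
  have happrox : ‖LogSource.companion A R α (LogSource.fracPow A p v)‖ ≤ D * H * c ^ p * ρ * W := by
    obtain ⟨h1, h2⟩ := hD v hv α hα0
    have h3 : ‖LogSource.companion A R α (LogSource.fracPow A p v)‖ ≤
        D * α ^ p * W * (H * (ℓ ^ ν)⁻¹) := by
      have hDW : 0 ≤ D * α ^ p * W := by positivity
      have hℓν : 0 < ℓ ^ ν := by positivity
      rcases le_total ℓ₁ ℓ with hle | hle
      · have h4 := hlog δ hδ hδ1 hle
        rw [← hα, ← hℓdef] at h4
        have h5 : 0 < ℓ / (2 * (p + 1)) := by positivity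
        refine (h2 ?_).trans (mul_le_mul_of_nonneg_left ?_ hDW)
        · exact (Real.log_neg_iff hα0).1 (by linarith)
        · calc ((-Real.log α) ^ ν)⁻¹ ≤ ((ℓ / (2 * (p + 1))) ^ ν)⁻¹ :=
                inv_anti₀ (by positivity) (pow_le_pow_left₀ h5.le h4 ν)
            _ = (2 * (p + 1)) ^ ν * (ℓ ^ ν)⁻¹ := by rw [div_pow, inv_div, div_eq_mul_inv]
            _ ≤ _ := mul_le_mul_of_nonneg_right (le_add_of_nonneg_right (by positivity))
                (by positivity)
      · refine h1.trans (le_mul_of_one_le_right hDW ?_)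
        rw [← div_eq_mul_inv, one_le_div hℓν]
        exact (pow_le_pow_left₀ hℓ.le hle ν).trans (le_add_of_nonneg_left (by positivity))
    refine h3.trans_eq ?_
    have h6 := LogSource.aprioriParam_rpow_mul hc hp ν hδ hδ1
    rw [← hα, ← hℓdef, ← hρ] at h6
    calc _ = D * H * W * (α ^ p * (ℓ ^ ν)⁻¹) := by ring
      _ = _ := by rw [h6]; ring
  have hW1 : W ≤ max W 1 := le_max_left _ _
  have h11 : (1 : ℝ) ≤ max W 1 := le_max_right _ _
  rw [hsplit]
  calc _ ≤ D * H * c ^ p * ρ * W + cs * c⁻¹ * ρ :=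
        (norm_sub_le _ _).trans (add_le_add happrox hdata)
    _ ≤ D * H * c ^ p * ρ * max W 1 + cs * c⁻¹ * ρ * max W 1 := by
        refine add_le_add (mul_le_mul_of_nonneg_left hW1 (by positivity))
          (le_mul_of_one_le_right (by positivity) h11)
    _ ≤ D * H * c ^ p * ρ * max W 1 + cs * c⁻¹ * ρ * max W 1 + ρ * max W 1 :=
        le_add_of_nonneg_right (by positivity)
    _ = _ := by ring
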